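/- Let $\mathcal{C}$ be a premodular category, i.e. a ribbon fusion category over $\mathbb{C}$: a $\mathbb{C}$-linear abelian semisimple rigid monoidal category with bilinear tensor product, finite-dimensional morphism spaces, finitely many simple objects up to isomorphism and simple unit $\mathbb{1}$, equipped with a braiding $c_{X,Y}\colon X\otimes Y\to Y\otimes X$ and a twist $\theta$, that is, a natural automorphism of the identity functor with $\theta_{X\otimes Y}=c_{Y,X}\,c_{X,Y}\,(\theta_X\otimes\theta_Y)$ and $\theta_{X^*}=(\theta_X)^*$. Let $X_b$ run through representatives of the isomorphism classes of simple objects, write $\theta_b\in\mathbb{C}^\times$ for the scalar by which $\theta$ acts on $X_b$, $d_b$ for the categorical (ribbon) dimension of $X_b$, $D^2=\sum_b d_b^2$, and $N_{bc}^a=\dim\operatorname{Hom}(X_b\otimes X_c,X_a)$. Let $\mathcal{C}'$ be the Müger center, consisting of the objects $X$ with $c_{Y,X}\,c_{X,Y}=\mathrm{id}_{X\otimes Y}$ for all $Y$, and let $R^{aa}_\gamma$ be the endomorphism $\psi\mapsto c_{X_a,X_a}\circ\psi$ of the vector space $\operatorname{Hom}(X_\gamma,X_a\otimes X_a)$. Let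 $\nu_2(X)=\operatorname{Tr}\bigl(E_X^{(2)}\bigr)$ be the second Frobenius–Schur indicator, where $E_X^{(2)}$ is the linear endomorphism of $\operatorname{Hom}(\mathbb{1},X\otimes X)$ given (suppressing associativity and unit isomorphisms) by $$E_X^{(2)}(f)=(\mathrm{ev}_X\otimes \mathrm{id}_{X\otimes X})\circ(\mathrm{id}_{X^*}\otimes f\otimes \mathrm{id}_X)\circ\mathrm{coev}'_X ,$$ with $\mathrm{ev}_X\colon X^*\otimes X\to\mathbb{1}$ the evaluation, $\mathrm{coev}_X\colon\mathbb{1}\to X\otimes X^*$ the coevaluation, and $\mathrm{coev}'_X=(\mathrm{id}_{X^*}\otimes\theta_X)\,c_{X,X^*}\,\mathrm{coev}_X\colon \mathbb{1}\to X^*\otimes X$. Then $D^2\neq 0$, and for every simple object $X_a$ with $X_a^*\cong X_a$, $$\nu_2(X_a)=\frac{1}{D^2}\sum_{b,c}N_{bc}^a\,d_b d_c\left(\frac{\theta_b}{\theta_c}\right)^2-\theta_a\sum_{X_\gamma\in\mathcal{C}',\ X_\gamma\not\cong\mathbb{1}}d_\gamma\operatorname{Tr}\bigl(R_\gamma^{aa}\bigr),$$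 where $b,c$ run over all, and $\gamma$ over the transparent nontrivial, isomorphism classes of simple objects. -/

import Mathlib

universe v u

namespace Premodular

open CategoryTheory MonoidalCategory Limits

noncomputable section

attribute [local instance] Abelian.hasFiniteBiproducts

/-- The isomorphism classes of simple objects of `C`. -/
def Irr (C : Type u) [Category.{v} C] [HasZeroMorphisms C] : Type u :=
  Quotient ((isIsomorphicSetoid C).comap (Subtype.val : {X : C // Simple X} → C))

/-- A chosen simple object in an isomorphism class of simple objects. -/
def Irr.rep {C : Type u} [Category.{v} C] [HasZeroMorphisms C] (b : Irr C) : C :=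
  (Quotient.out b).val

instance {C : Type u} [Category.{v} C] [HasZeroMorphisms C] (b : Irr C) : Simple b.rep :=
  (Quotient.out b).property

/-- Every simple object is isomorphic to exactly one chosen representative. -/
theorem Irr.existsUnique_iso {C : Type u} [Category.{v} C] [HasZeroMorphisms C]
    (X : C) [hX : Simple X] : ∃! b : Irr C, Nonempty (b.rep ≅ X) := by
  refine ⟨Quotient.mk _ ⟨X, hX⟩, ?_, ?_⟩
  · exact Quotient.mk_out
      (s := (isIsomorphicSetoid C).comap (Subtype.val : {X : C // Simple X} → C)) ⟨X, hX⟩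
  · intro c hc
    rw [← Quotient.out_eq c]
    exact Quotient.sound hc

/-- Fusion category over `ℂ`: a `ℂ`-linear abelian rigid monoidal category with bilinear tensor
product, which is semisimple with finite-dimensional morphism spaces and finitely many simple
objects up to isomorphism, and whose unit object is simple. (Abelianness, linearity, the monoidal
structure and rigidity are given by the type classes of Mathlib in the binders. In the presence of
a braiding, a right dual is also a left dual, so only one kind of dual is asked for.) -/
class FusionCategory (C : Type u) [Category.{v} C] [Abelian C] [Linear ℂ C] [MonoidalCategory C]
    [MonoidalPreadditive C] [MonoidalLinear ℂ C] [RightRigidCategory C] : Prop where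
  finiteDimensional_hom : ∀ X Y : C, FiniteDimensional ℂ (X ⟶ Y)
  semisimple : ∀ X : C, ∃ (n : ℕ) (S : Fin n → C), (∀ i, Simple (S i)) ∧ Nonempty (X ≅ ⨁ S)
  finite_irr : Finite (Irr C)
  simple_unit : Simple (𝟙_ C)

attribute [instance] FusionCategory.finiteDimensional_hom FusionCategory.simple_unit

/-- Ribbon structure on a braided rigid category: a balancing (twist) `θ` compatible with duals,
`θ_{X ⊗ Y} = c_{Y,X} ∘ c_{X,Y} ∘ (θ_X ⊗ θ_Y)` and `θ_{X*} = (θ_X)*`. Here `X* = Xᘁ`, with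
`ε_ X Xᘁ : Xᘁ ⊗ X ⟶ 𝟙_ C` and `η_ X Xᘁ : 𝟙_ C ⟶ X ⊗ Xᘁ` the evaluation and coevaluation. -/
class RibbonCategory (C : Type u) [Category.{v} C] [MonoidalCategory C] [BraidedCategory C]
    [RightRigidCategory C] where
  twist : ∀ X : C, X ≅ X
  twist_naturality : ∀ {X Y : C} (f : X ⟶ Y), f ≫ (twist Y).hom = (twist X).hom ≫ f
  twist_tensor : ∀ X Y : C, (twist (X ⊗ Y)).hom =
    ((twist X).hom ⊗ₘ (twist Y).hom) ≫ (β_ X Y).hom ≫ (β_ Y X).hom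
  twist_dual : ∀ X : C, (twist Xᘁ).hom = ((twist X).hom)ᘁ

open RibbonCategory (twist)

/-- The scalar `z` by which an endomorphism `f = z • 𝟙 X` of a simple object acts. -/
def scalar {C : Type u} [Category.{v} C] [Abelian C] [Linear ℂ C] [MonoidalCategory C]
    [MonoidalPreadditive C] [MonoidalLinear ℂ C] [RightRigidCategory C] [FusionCategory C]
    {X : C} [Simple X] (f : X ⟶ X) : ℂ :=
  (endomorphism_simple_eq_smul_id ℂ f).choose

theorem scalar_smul_id {C : Type u} [Category.{v} C] [Abelian C] [Linear ℂ C]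
    [MonoidalCategory C] [MonoidalPreadditive C] [MonoidalLinear ℂ C] [RightRigidCategory C]
    [FusionCategory C] {X : C} [Simple X] (f : X ⟶ X) : scalar f • 𝟙 X = f :=
  (endomorphism_simple_eq_smul_id ℂ f).choose_spec

variable {C : Type u} [Category.{v} C] [Abelian C] [Linear ℂ C] [MonoidalCategory C]
  [MonoidalPreadditive C] [MonoidalLinear ℂ C] [RightRigidCategory C] [BraidedCategory C]
  [RibbonCategory C] [FusionCategory C]

/-- The evaluation `X ⊗ X* ⟶ 𝟙` on the other side, given by the ribbon structure. -/
def evRight (X : C) : X ⊗ Xᘁ ⟶ 𝟙_ C :=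
  ((twist X).hom ▷ Xᘁ) ≫ (β_ X Xᘁ).hom ≫ ε_ X Xᘁ

/-- The coevaluation `𝟙 ⟶ X* ⊗ X` on the other side, given by the ribbon structure. -/
def coevRight (X : C) : 𝟙_ C ⟶ Xᘁ ⊗ X :=
  η_ X Xᘁ ≫ (β_ X Xᘁ).hom ≫ (Xᘁ ◁ (twist X).hom)

/-- The categorical trace of an endomorphism. -/
def qtrace {X : C} (f : X ⟶ X) : ℂ :=
  scalar (η_ X Xᘁ ≫ (f ▷ Xᘁ) ≫ evRight X)

/-- The dimension `d_X`. -/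
def dim (X : C) : ℂ := qtrace (𝟙 X)

/-- The twist `θ_X` of a simple object, as a number. -/
def twistScalar (X : C) [Simple X] : ℂ := scalar (twist X).hom

/-- The multiplicity `N_{X,Y}^Z = dim Hom(X ⊗ Y, Z)`. -/
def fusionCoeff (X Y Z : C) : ℕ := Module.finrank ℂ (X ⊗ Y ⟶ Z)

instance : Fintype (Irr C) :=
  haveI : Finite (Irr C) := FusionCategory.finite_irr
  Fintype.ofFinite _

variable (C) in
/-- The global dimension `D² = ∑_b d_b²`. -/
def globalDim : ℂ := ∑ b : Irr C, dim b.rep ^ 2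

/-- `X` lies in the Müger center. -/
def IsTransparent (X : C) : Prop := ∀ Y : C, (β_ X Y).hom ≫ (β_ Y X).hom = 𝟙 (X ⊗ Y)

/-- The operator `R_Z^{XX}` on the splitting space `Hom(Z, X ⊗ X)`: composition with the
braiding of `X` with itself. -/
def RMatrix (Z X : C) : (Z ⟶ X ⊗ X) →ₗ[ℂ] (Z ⟶ X ⊗ X) :=
  Linear.rightComp ℂ Z (β_ X X).hom

/-- The rotation operator `E_X^{(2)}` on `Hom(𝟙, X ⊗ X)`: the first tensor factor of `f` is bent
to the left with the evaluation `X* ⊗ X ⟶ 𝟙`, and comes back as the last factor. -/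
def rotation (X : C) : (𝟙_ C ⟶ X ⊗ X) →ₗ[ℂ] (𝟙_ C ⟶ X ⊗ X) where
  toFun f := coevRight X ≫ (Xᘁ ◁ (λ_ X).inv) ≫ (Xᘁ ◁ (f ▷ X)) ≫ (Xᘁ ◁ (α_ X X X).hom) ≫
    (α_ Xᘁ X (X ⊗ X)).inv ≫ (ε_ X Xᘁ ▷ (X ⊗ X)) ≫ (λ_ (X ⊗ X)).hom
  map_add' f g := by
    simp [MonoidalPreadditive.add_whiskerRight, MonoidalPreadditive.whiskerLeft_add]
  map_smul' z f := by
    simp [MonoidalLinear.smul_whiskerRight, MonoidalLinear.whiskerLeft_smul]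

/-- The second Frobenius–Schur indicator `ν₂(X) = Tr(E_X^{(2)})`. -/
def secondIndicator (X : C) : ℂ := LinearMap.trace ℂ (𝟙_ C ⟶ X ⊗ X) (rotation X)

end

end Premodular

/-! Close the crossing of two `X`-strands into a loop diagram and encircle both strands by a loop
carrying the Kirby colour, the sum of all simple colours `b` weighted by `d_b`. The formula compares
two evaluations of this number.

Locally, on a simple summand `γ` of `X ⊗ X` the Kirby loop is `D²` if `γ` is transparent and `0`
otherwise, giving `D² ∑ d_γ Tr(R_γ)` over transparent `γ`. The vanishing comes from the handle slide
`kirby_whiskerRight`: a strand leaving a Kirby loop may be unlinked from any other strand, so by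
Schur's lemma a nonzero value forces transparency.

Globally, for one colour `b`, Yang–Baxter and the closure of one `X`-strand turn the diagram into
`b` winding twice around a single twisted `X` (`Tr_encircle_braiding`). The double braiding is a
ratio of twists by balancing, so `b ⊗ X` contributes squared twist ratios weighted by fusion
multiplicities; duality of `b` brings these to the stated form.

Finally the rotation operator is `θ_X R_𝟙` (`rotation_formula`), so the indicator is the `γ = 𝟙`
term of the local evaluation. Dividing by `D²` is legitimate because dimensions are real
(`conj_dim`) and `d_𝟙 = 1`. -/

namespace Premodular

open CategoryTheory MonoidalCategory Limits

noncomputable section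

open ExactPairing
open RibbonCategory (twist twist_naturality twist_tensor twist_dual)

set_option linter.unusedSectionVars false

attribute [local instance] Abelian.hasFiniteBiproducts

/-! ### Twists, reversed duality and its compatibility with tensor products, for arbitrary exact
pairings. -/

section Ribbon

variable {C : Type u} [Category.{v} C] [MonoidalCategory C] [BraidedCategory C]
  [RightRigidCategory C] [RibbonCategory C]

/-- Naturality along `𝟙 ⊗ 𝟙 ≅ 𝟙`, where the braiding is trivial, makes the twist idempotent; it is
invertible. -/
theorem twist_unit : (twist (𝟙_ C)).hom = 𝟙 (𝟙_ C) := by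
  have h := twist_tensor (𝟙_ C) (𝟙_ C)
  have h2 := twist_naturality (λ_ (𝟙_ C)).hom
  rw [h] at h2
  have h3 : ((twist (𝟙_ C)).hom ⊗ₘ (twist (𝟙_ C)).hom) ≫ (λ_ (𝟙_ C)).hom =
      (λ_ (𝟙_ C)).hom ≫ (twist (𝟙_ C)).hom ≫ (twist (𝟙_ C)).hom := by
    rw [MonoidalCategory.tensorHom_def, Category.assoc, leftUnitor_naturality, unitors_equal,
      rightUnitor_naturality_assoc]
  have h4 : (β_ (𝟙_ C) (𝟙_ C)).hom = 𝟙 _ := by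
    rw [braiding_tensorUnit_left, unitors_equal, Iso.hom_inv_id]
  rw [h4, Category.comp_id, Category.comp_id, h3, cancel_epi] at h2
  rw [← cancel_epi (twist (𝟙_ C)).hom, ← h2, Category.comp_id]

/-- The evaluation `X ⊗ W ⟶ 𝟙` on the other side of an exact pairing. -/
def evR (X W : C) [ExactPairing X W] : X ⊗ W ⟶ 𝟙_ C :=
  ((twist X).hom ▷ W) ≫ (β_ X W).hom ≫ ε_ X W

/-- The coevaluation `𝟙 ⟶ W ⊗ X` on the other side of an exact pairing. -/
def coevR (X W : C) [ExactPairing X W] : 𝟙_ C ⟶ W ⊗ X :=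
  η_ X W ≫ (β_ X W).hom ≫ (W ◁ (twist X).hom)

theorem coevaluation_twist_rightDual (X : C) :
    η_ X Xᘁ ≫ X ◁ (twist Xᘁ).hom = η_ X Xᘁ ≫ (twist X).hom ▷ Xᘁ := by
  rw [twist_dual, coevaluation_comp_rightAdjointMate]

/-- The comparison of two right duals of the same object. -/
def dualComparison (X W W' : C) [ExactPairing X W] [ExactPairing X W'] : W ⟶ W' :=
  (rightDualIso (‹_› : ExactPairing X W) (‹_› : ExactPairing X W')).hom

theorem coevaluation_dualComparison (X W W' : C) [h1 : ExactPairing X W] [h2 : ExactPairing X W'] :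
    η_ X W ≫ X ◁ dualComparison X W W' = η_ X W' := by
  have := @coevaluation_comp_rightAdjointMate _ _ _ X X (@HasRightDual.mk _ _ _ X W' h2)
    (@HasRightDual.mk _ _ _ X W h1) (𝟙 X)
  simpa [dualComparison, rightDualIso] using this

theorem coevaluation_twist (X W : C) [ExactPairing X W] :
    η_ X W ≫ X ◁ (twist W).hom = η_ X W ≫ (twist X).hom ▷ W := by
  rw [← coevaluation_dualComparison X Xᘁ W]
  simp only [Category.assoc, ← whiskerLeft_comp, twist_naturality]
  rw [whiskerLeft_comp, reassoc_of% coevaluation_twist_rightDual X, whisker_exchange]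

/-- Naturality of the twist along the coevaluation, with both twists collected on `X`. -/
theorem coevaluation_double_braiding (X W : C) [ExactPairing X W] :
    η_ X W ≫ (twist X).hom ▷ W ≫ (twist X).hom ▷ W ≫ (β_ X W).hom ≫ (β_ W X).hom = η_ X W := by
  have h := twist_naturality (η_ X W)
  rw [twist_unit, Category.id_comp, twist_tensor, tensorHom_def', Category.assoc,
    reassoc_of% coevaluation_twist X W] at h
  exact h

/-- In this form the reversed pairing is the braided swap transported along the twist, so its zigzag
identities come for free. -/
theorem coevR_eq (X W : C) [ExactPairing X W] :
    coevR X W = (η_ X W ≫ (β_ W X).inv) ≫ W ◁ (twist X).inv := by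
  have h := coevaluation_double_braiding X W
  rw [coevR]
  conv_rhs => rw [← h]
  simp

/-- The reversed exact pairing given by the ribbon structure. -/
@[reducible]
def reversePairing (X W : C) [ExactPairing X W] : ExactPairing W X where
  coevaluation' := coevR X W
  evaluation' := evR X W
  coevaluation_evaluation' := by
    rw [coevR_eq]
    let := BraidedCategory.exactPairing_swap X W
    exact (exactPairingCongrRight (X := W) (twist X)).coevaluation_evaluation'
  evaluation_coevaluation' := by
    rw [coevR_eq]
    let := BraidedCategory.exactPairing_swap X W
    exact (exactPairingCongrRight (X := W) (twist X)).evaluation_coevaluation'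

/-- Reversing twice restores the evaluation: the two twists and the two crossings form the twist of
`W ⊗ X`, which `ε` absorbs. -/
theorem evR_reverse (X W : C) [ExactPairing X W] :
    @evR _ _ _ _ _ _ W X (reversePairing X W) = ε_ X W := by
  have h := twist_naturality (ε_ X W)
  rw [twist_unit, Category.comp_id, twist_tensor, MonoidalCategory.tensorHom_def] at h
  conv_rhs => rw [h]
  rw [evR]
  change _ ≫ _ ≫ evR X W = _
  simp [evR]

theorem braiding_slide (Z : C) {U V : C} (e : U ⊗ V ⟶ 𝟙_ C) :
    (β_ Z U).hom ▷ V ⊗≫ U ◁ (β_ Z V).hom ⊗≫ e ▷ Z = 𝟙 _ ⊗≫ Z ◁ e ⊗≫ 𝟙 _ := by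
  calc
    _ = 𝟙 _ ⊗≫ ((β_ Z (U ⊗ V)).hom ≫ e ▷ Z) ⊗≫ 𝟙 _ := by
      rw [BraidedCategory.braiding_tensor_right_hom]; monoidal
    _ = _ := by
      rw [← BraidedCategory.braiding_naturality_right, braiding_tensorUnit_right]; monoidal

/-- Yang–Baxter exposes a strand passing a cap, and `braiding_slide` pulls it off; a second slide
removes the remaining crossings. -/
theorem double_braiding_evaluation_tensor (X₁ X₂ W₁ W₂ : C) [ExactPairing X₁ W₁]
    [ExactPairing X₂ W₂] :
    ((β_ X₁ X₂).hom ≫ (β_ X₂ X₁).hom) ▷ (W₂ ⊗ W₁) ≫ (β_ (X₁ ⊗ X₂) (W₂ ⊗ W₁)).hom ≫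
        ε_ (X₁ ⊗ X₂) (W₂ ⊗ W₁) =
      𝟙 _ ⊗≫ X₁ ◁ ((β_ X₂ W₂).hom ≫ ε_ X₂ W₂) ▷ W₁ ⊗≫ ((β_ X₁ W₁).hom ≫ ε_ X₁ W₁) := by
  calc
    _ = 𝟙 _ ⊗≫ (β_ X₁ X₂).hom ▷ W₂ ▷ W₁ ⊗≫
        ((β_ X₂ X₁).hom ▷ W₂ ⊗≫ X₁ ◁ (β_ X₂ W₂).hom) ▷ W₁ ⊗≫
        (((X₁ ⊗ W₂) ◁ (β_ X₂ W₁).hom) ≫ (β_ X₁ W₂).hom ▷ (W₁ ⊗ X₂)) ⊗≫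
        W₂ ◁ (((β_ X₁ W₁).hom ≫ ε_ X₁ W₁) ▷ X₂) ⊗≫ ε_ X₂ W₂ := by
      rw [BraidedCategory.braiding_tensor_left_hom, BraidedCategory.braiding_tensor_right_hom,
        BraidedCategory.braiding_tensor_right_hom, tensor_evaluation]
      monoidal
    _ = 𝟙 _ ⊗≫ (β_ X₁ X₂).hom ▷ W₂ ▷ W₁ ⊗≫
        ((β_ X₂ X₁).hom ▷ W₂ ⊗≫ X₁ ◁ (β_ X₂ W₂).hom ⊗≫ (β_ X₁ W₂).hom ▷ X₂) ▷ W₁ ⊗≫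
        W₂ ◁ (X₁ ◁ (β_ X₂ W₁).hom ⊗≫ ((β_ X₁ W₁).hom ≫ ε_ X₁ W₁) ▷ X₂) ⊗≫ ε_ X₂ W₂ := by
      rw [whisker_exchange]; monoidal
    _ = 𝟙 _ ⊗≫ (β_ X₁ X₂).hom ▷ W₂ ▷ W₁ ⊗≫ X₂ ◁ (β_ X₁ W₂).hom ▷ W₁ ⊗≫
        (β_ X₂ W₂).hom ▷ X₁ ▷ W₁ ⊗≫
        W₂ ◁ ((β_ X₂ X₁).hom ▷ W₁ ⊗≫ X₁ ◁ (β_ X₂ W₁).hom ⊗≫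
          ((β_ X₁ W₁).hom ≫ ε_ X₁ W₁) ▷ X₂) ⊗≫ ε_ X₂ W₂ := by
      rw [BraidedCategory.yang_baxter']; monoidal
    _ = 𝟙 _ ⊗≫ (β_ X₁ X₂).hom ▷ W₂ ▷ W₁ ⊗≫ X₂ ◁ (β_ X₁ W₂).hom ▷ W₁ ⊗≫
        (β_ X₂ W₂).hom ▷ X₁ ▷ W₁ ⊗≫
        ((W₂ ⊗ X₂) ◁ ((β_ X₁ W₁).hom ≫ ε_ X₁ W₁) ≫ ε_ X₂ W₂ ▷ 𝟙_ C) ⊗≫ 𝟙 _ := by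
      rw [braiding_slide]; monoidal
    _ = 𝟙 _ ⊗≫ ((β_ X₁ X₂).hom ▷ W₂ ⊗≫ X₂ ◁ (β_ X₁ W₂).hom ⊗≫
        ((β_ X₂ W₂).hom ≫ ε_ X₂ W₂) ▷ X₁) ▷ W₁ ⊗≫ ((β_ X₁ W₁).hom ≫ ε_ X₁ W₁) ⊗≫ 𝟙 _ := by
      rw [whisker_exchange]; monoidal
    _ = _ := by
      rw [braiding_slide]; monoidal

/-- The double braiding inside the twist of `X₁ ⊗ X₂` undoes the crossings between the two caps,
leaving nested caps. This lets traces over tensor products be taken one factor at a time. -/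
theorem evR_tensor (X₁ X₂ W₁ W₂ : C) [ExactPairing X₁ W₁] [ExactPairing X₂ W₂] :
    evR (X₁ ⊗ X₂) (W₂ ⊗ W₁) = 𝟙 _ ⊗≫ X₁ ◁ (evR X₂ W₂ ▷ W₁) ⊗≫ evR X₁ W₁ := by
  calc
    _ = 𝟙 _ ⊗≫ ((twist X₁).hom ▷ X₂ ≫ X₁ ◁ (twist X₂).hom) ▷ (W₂ ⊗ W₁) ⊗≫
        (((β_ X₁ X₂).hom ≫ (β_ X₂ X₁).hom) ▷ (W₂ ⊗ W₁) ≫ (β_ (X₁ ⊗ X₂) (W₂ ⊗ W₁)).hom ≫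
        ε_ (X₁ ⊗ X₂) (W₂ ⊗ W₁)) := by
      rw [evR, twist_tensor, MonoidalCategory.tensorHom_def]; monoidal
    _ = 𝟙 _ ⊗≫ ((twist X₁).hom ▷ (X₂ ⊗ W₂) ≫
        X₁ ◁ ((twist X₂).hom ▷ W₂ ≫ (β_ X₂ W₂).hom ≫ ε_ X₂ W₂)) ▷ W₁ ⊗≫
        ((β_ X₁ W₁).hom ≫ ε_ X₁ W₁) := by
      rw [double_braiding_evaluation_tensor]; monoidal
    _ = _ := by
      rw [← whisker_exchange]; simp only [evR]; monoidal

end Ribbon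

/-! ### Graphical calculus of partial traces. -/

section PartialTrace

variable {C : Type u} [Category.{v} C] [MonoidalCategory C] [BraidedCategory C]
  [RightRigidCategory C] [RibbonCategory C]

/-- The mate of a morphism with respect to two exact pairings. -/
def mate {V V' : C} (W W' : C) [ExactPairing V W] [ExactPairing V' W'] (f : V ⟶ V') : W' ⟶ W :=
  letI : HasRightDual V := ⟨W⟩
  letI : HasRightDual V' := ⟨W'⟩
  rightAdjointMate f

theorem coevaluation_comp_mate {V V' : C} (W W' : C) [ExactPairing V W] [ExactPairing V' W']
    (f : V ⟶ V') : η_ V' W' ≫ V' ◁ mate W W' f = η_ V W ≫ f ▷ W :=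
  letI : HasRightDual V := ⟨W⟩
  letI : HasRightDual V' := ⟨W'⟩
  coevaluation_comp_rightAdjointMate f

theorem mate_comp_evaluation {V V' : C} (W W' : C) [ExactPairing V W] [ExactPairing V' W']
    (f : V ⟶ V') : mate W W' f ▷ V ≫ ε_ V W = W' ◁ f ≫ ε_ V' W' :=
  letI : HasRightDual V := ⟨W⟩
  letI : HasRightDual V' := ⟨W'⟩
  rightAdjointMate_comp_evaluation f

theorem mate_comp_evR {V V' : C} (W W' : C) [ExactPairing V W] [ExactPairing V' W']
    (f : V ⟶ V') : V ◁ mate W W' f ≫ evR V W = f ▷ W' ≫ evR V' W' := by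
  rw [evR, evR, whisker_exchange_assoc, BraidedCategory.braiding_naturality_right_assoc,
    mate_comp_evaluation, ← comp_whiskerRight_assoc, twist_naturality, comp_whiskerRight_assoc,
    ← BraidedCategory.braiding_naturality_left_assoc]

/-- The partial trace of a morphism `P ⊗ V ⟶ Q ⊗ V` over `V`. -/
def ptr (V W : C) [ExactPairing V W] {P Q : C} (f : P ⊗ V ⟶ Q ⊗ V) : P ⟶ Q :=
  (ρ_ P).inv ≫ P ◁ η_ V W ≫ (α_ P V W).inv ≫ f ▷ W ≫ (α_ Q V W).hom ≫ Q ◁ evR V W ≫ (ρ_ Q).hom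

/-- The trace of an endomorphism, as an endomorphism of the unit. -/
def Tr (V W : C) [ExactPairing V W] (f : V ⟶ V) : 𝟙_ C ⟶ 𝟙_ C :=
  η_ V W ≫ f ▷ W ≫ evR V W

theorem ptr_leftUnitor (V W : C) [ExactPairing V W] (f : V ⟶ V) :
    ptr V W ((λ_ V).hom ≫ f ≫ (λ_ V).inv) = Tr V W f := by
  rw [ptr, Tr]; monoidal

theorem ptr_whiskerRight_comp (V W : C) [ExactPairing V W] {P P' Q : C} (g : P' ⟶ P)
    (f : P ⊗ V ⟶ Q ⊗ V) : ptr V W (g ▷ V ≫ f) = g ≫ ptr V W f := by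
  calc
    _ = 𝟙 _ ⊗≫ (P' ◁ η_ V W ≫ g ▷ (V ⊗ W)) ⊗≫ f ▷ W ⊗≫ Q ◁ evR V W ⊗≫ 𝟙 _ := by
      rw [ptr]; monoidal
    _ = _ := by
      rw [whisker_exchange, ptr]; monoidal

theorem ptr_comp_whiskerRight (V W : C) [ExactPairing V W] {P Q Q' : C}
    (f : P ⊗ V ⟶ Q ⊗ V) (g : Q ⟶ Q') : ptr V W (f ≫ g ▷ V) = ptr V W f ≫ g := by
  calc
    _ = 𝟙 _ ⊗≫ P ◁ η_ V W ⊗≫ f ▷ W ⊗≫ (g ▷ (V ⊗ W) ≫ Q' ◁ evR V W) ⊗≫ 𝟙 _ := by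
      rw [ptr]; monoidal
    _ = _ := by
      rw [← whisker_exchange, ptr]; monoidal

/-- `u` travels around the loop: it crosses the coevaluation as its mate, and becomes `u` again at
the reversed evaluation. -/
theorem ptr_dinatural (V W V' W' : C) [ExactPairing V W] [ExactPairing V' W'] {P Q : C}
    (u : V ⟶ V') (f : P ⊗ V' ⟶ Q ⊗ V) : ptr V W (P ◁ u ≫ f) = ptr V' W' (f ≫ Q ◁ u) := by
  calc
    _ = 𝟙 _ ⊗≫ P ◁ (η_ V W ≫ u ▷ W) ⊗≫ f ▷ W ⊗≫ Q ◁ evR V W ⊗≫ 𝟙 _ := by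
      rw [ptr]; monoidal
    _ = 𝟙 _ ⊗≫ P ◁ η_ V' W' ⊗≫ ((P ⊗ V') ◁ mate W W' u ≫ f ▷ W) ⊗≫ Q ◁ evR V W ⊗≫ 𝟙 _ := by
      rw [← coevaluation_comp_mate W W']; monoidal
    _ = 𝟙 _ ⊗≫ P ◁ η_ V' W' ⊗≫ f ▷ W' ⊗≫ Q ◁ (V ◁ mate W W' u ≫ evR V W) ⊗≫ 𝟙 _ := by
      rw [whisker_exchange]; monoidal
    _ = _ := by
      rw [mate_comp_evR, ptr]; monoidal

theorem ptr_tensor (V₁ W₁ V₂ W₂ : C) [ExactPairing V₁ W₁] [ExactPairing V₂ W₂] {P Q : C}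
    (f : P ⊗ (V₁ ⊗ V₂) ⟶ Q ⊗ (V₁ ⊗ V₂)) :
    ptr (V₁ ⊗ V₂) (W₂ ⊗ W₁) f =
      ptr V₁ W₁ (ptr V₂ W₂ ((α_ P V₁ V₂).hom ≫ f ≫ (α_ Q V₁ V₂).inv)) := by
  rw [ptr, evR_tensor, tensor_coevaluation, ptr, ptr]
  monoidal

theorem ptr_whiskerLeft (V W : C) [ExactPairing V W] (Z : C) {P Q : C} (f : P ⊗ V ⟶ Q ⊗ V) :
    ptr V W ((α_ Z P V).hom ≫ Z ◁ f ≫ (α_ Z Q V).inv) = Z ◁ ptr V W f := by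
  rw [ptr, ptr]
  monoidal

theorem ptr_whiskerLeft_end (V W : C) [ExactPairing V W] (Z : C) (f : V ⟶ V) :
    ptr V W (Z ◁ f) = (ρ_ Z).inv ≫ Z ◁ Tr V W f ≫ (ρ_ Z).hom := by
  rw [ptr, Tr]
  monoidal

/-- The twist in `evR` slides through the crossing; naturality of the braiding at `η` then reduces
the curl to a zigzag. -/
theorem ptr_braiding (X W : C) [ExactPairing X W] : ptr X W (β_ X X).hom = (twist X).hom := by
  calc
    _ = 𝟙 _ ⊗≫ X ◁ η_ X W ⊗≫ ((β_ X X).hom ≫ X ◁ (twist X).hom) ▷ W ⊗≫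
        X ◁ (β_ X W).hom ⊗≫ X ◁ ε_ X W ⊗≫ 𝟙 _ := by
      rw [ptr, evR]; monoidal
    _ = 𝟙 _ ⊗≫ (X ◁ η_ X W ≫ (twist X).hom ▷ (X ⊗ W)) ⊗≫ (β_ X X).hom ▷ W ⊗≫
        X ◁ (β_ X W).hom ⊗≫ X ◁ ε_ X W ⊗≫ 𝟙 _ := by
      rw [← BraidedCategory.braiding_naturality_left]; monoidal
    _ = 𝟙 _ ⊗≫ (twist X).hom ⊗≫ (X ◁ η_ X W ≫ (β_ X (X ⊗ W)).hom) ⊗≫ X ◁ ε_ X W ⊗≫ 𝟙 _ := by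
      rw [whisker_exchange, BraidedCategory.braiding_tensor_right_hom]; monoidal
    _ = 𝟙 _ ⊗≫ (twist X).hom ⊗≫ (η_ X W ▷ X ⊗≫ X ◁ ε_ X W) ⊗≫ 𝟙 _ := by
      rw [BraidedCategory.braiding_naturality_right, braiding_tensorUnit_right]; monoidal
    _ = _ := by
      rw [evaluation_coevaluation'']; monoidal

theorem Tr_tensor (V₁ W₁ V₂ W₂ : C) [ExactPairing V₁ W₁] [ExactPairing V₂ W₂]
    (f : V₁ ⊗ V₂ ⟶ V₁ ⊗ V₂) :
    Tr (V₁ ⊗ V₂) (W₂ ⊗ W₁) f = Tr V₁ W₁ (ptr V₂ W₂ f) := by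
  rw [Tr, evR_tensor, tensor_coevaluation, ptr, Tr]
  monoidal

theorem Tr_comm {V V' : C} (W W' : C) [ExactPairing V W] [ExactPairing V' W']
    (f : V ⟶ V') (g : V' ⟶ V) : Tr V W (f ≫ g) = Tr V' W' (g ≫ f) := by
  rw [← ptr_leftUnitor, ← ptr_leftUnitor]
  have := ptr_dinatural V W V' W' f ((λ_ V').hom ≫ g ≫ (λ_ V).inv)
  simpa using this

theorem Tr_reverse (V W : C) [ExactPairing V W] (g : W ⟶ W) :
    letI := reversePairing V W
    Tr W V g = η_ V W ≫ V ◁ g ≫ evR V W := by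
  rw [Tr, evR_reverse]
  change coevR V W ≫ _ = _
  simp [coevR, evR, ← whisker_exchange_assoc]

/-- The left partial trace can be computed with right traces. -/
theorem Tr_leftTrace (V W c c' : C) [ExactPairing V W] [ExactPairing c c']
    (f : W ⊗ c ⟶ W ⊗ c) :
    letI := reversePairing V W
    Tr c c' ((λ_ c).inv ≫ η_ V W ▷ c ≫ (α_ V W c).hom ≫ V ◁ f ≫ (α_ V W c).inv ≫
      evR V W ▷ c ≫ (λ_ c).hom) = Tr (W ⊗ c) (c' ⊗ V) f := by
  let := reversePairing V W
  rw [Tr_tensor, Tr_reverse]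
  calc
    _ = 𝟙 _ ⊗≫ (𝟙_ C ◁ η_ c c' ≫ η_ V W ▷ (c ⊗ c')) ⊗≫ V ◁ f ▷ c' ⊗≫
        (evR V W ▷ (c ⊗ c') ≫ 𝟙_ C ◁ evR c c') ⊗≫ 𝟙 _ := by
      rw [Tr]; monoidal
    _ = _ := by
      rw [← whisker_exchange, whisker_exchange (η_ V W), ptr]; monoidal

theorem ptr_zigzag (V W : C) [ExactPairing V W] {P Q : C} (g : P ⟶ Q) :
    letI := reversePairing V W
    ptr W V ((α_ P V W).hom ≫ P ◁ evR V W ≫ (ρ_ P).hom ≫ g ≫ (ρ_ Q).inv ≫ Q ◁ η_ V W ≫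
      (α_ Q V W).inv) = g ▷ V := by
  let := reversePairing V W
  calc
    _ = 𝟙 _ ⊗≫ P ◁ (V ◁ η_ W V ⊗≫ ε_ W V ▷ V) ⊗≫ g ▷ V ⊗≫
        Q ◁ (η_ V W ▷ V ⊗≫ V ◁ ε_ V W) ⊗≫ 𝟙 _ := by
      rw [ptr, evR_reverse]
      change _ = 𝟙 _ ⊗≫ P ◁ (V ◁ η_ W V ⊗≫ evR V W ▷ V) ⊗≫ g ▷ V ⊗≫
        Q ◁ (η_ V W ▷ V ⊗≫ V ◁ ε_ V W) ⊗≫ 𝟙 _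
      monoidal
    _ = _ := by
      rw [coevaluation_evaluation'', evaluation_coevaluation'']; monoidal

/-- Tracing out `W` joins the cap and the cup on `V` into one straight strand beside the loop `c`.
-/
theorem ptr_slide (V W c c' : C) [ExactPairing V W] [ExactPairing c c'] {P Q : C}
    (f : P ⊗ c ⟶ Q ⊗ c) :
    letI := reversePairing V W
    ptr (W ⊗ c) (c' ⊗ V)
      (((α_ P V (W ⊗ c)).hom ≫ P ◁ ((α_ V W c).inv ≫ evR V W ▷ c ≫ (λ_ c).hom)) ≫ f ≫
        Q ◁ ((λ_ c).inv ≫ η_ V W ▷ c ≫ (α_ V W c).hom) ≫ (α_ Q V (W ⊗ c)).inv) =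
      ptr c c' f ▷ V := by
  let := reversePairing V W
  have h : (α_ (P ⊗ V) W c).hom ≫
      (((α_ P V (W ⊗ c)).hom ≫ P ◁ ((α_ V W c).inv ≫ evR V W ▷ c ≫ (λ_ c).hom)) ≫ f ≫
        Q ◁ ((λ_ c).inv ≫ η_ V W ▷ c ≫ (α_ V W c).hom) ≫ (α_ Q V (W ⊗ c)).inv) ≫
        (α_ (Q ⊗ V) W c).inv =
      ((α_ P V W).hom ≫ P ◁ evR V W ≫ (ρ_ P).hom) ▷ c ≫
        f ≫ ((ρ_ Q).inv ≫ Q ◁ η_ V W ≫ (α_ Q V W).inv) ▷ c := by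
    monoidal
  rw [ptr_tensor, h, ptr_whiskerRight_comp, ptr_comp_whiskerRight]
  simpa using ptr_zigzag V W (ptr c c' f)

end PartialTrace

/-! ### Encircling loops and the rotation operator. -/

section Encircling

variable {C : Type u} [Category.{v} C] [MonoidalCategory C] [BraidedCategory C]
  [RightRigidCategory C] [RibbonCategory C]

/-- The double braiding. -/
def doubleBraiding (X Y : C) : X ⊗ Y ⟶ X ⊗ Y := (β_ X Y).hom ≫ (β_ Y X).hom

theorem doubleBraiding_naturality_left {X X' : C} (f : X ⟶ X') (Y : C) :
    f ▷ Y ≫ doubleBraiding X' Y = doubleBraiding X Y ≫ f ▷ Y := by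
  simp [doubleBraiding]

theorem doubleBraiding_naturality_right {Y Y' : C} (X : C) (f : Y ⟶ Y') :
    X ◁ f ≫ doubleBraiding X Y' = doubleBraiding X Y ≫ X ◁ f := by
  simp [doubleBraiding]

theorem doubleBraiding_tensor_right (Y Z b : C) :
    (α_ Y Z b).hom ≫ doubleBraiding Y (Z ⊗ b) ≫ (α_ Y Z b).inv =
      (β_ Y Z).hom ▷ b ≫ ((α_ Z Y b).hom ≫ Z ◁ doubleBraiding Y b ≫ (α_ Z Y b).inv) ≫
        (β_ Z Y).hom ▷ b := by
  simp [doubleBraiding]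

/-- The endomorphism of `Y` given by a loop coloured by `b` around the strand `Y`. -/
def encircle (b b' : C) [ExactPairing b b'] (Y : C) : Y ⟶ Y := ptr b b' (doubleBraiding Y b)

theorem encircle_naturality (b b' : C) [ExactPairing b b'] {Y Y' : C} (f : Y ⟶ Y') :
    f ≫ encircle b b' Y' = encircle b b' Y ≫ f := by
  rw [encircle, encircle, ← ptr_whiskerRight_comp, ← ptr_comp_whiskerRight,
    doubleBraiding_naturality_left]

/-- First half of the handle slide: the loop around `Y` and the full turn of `Z` around `Y` merge
into a full turn of `Z ⊗ b`. -/
theorem ptr_doubleBraiding_tensor (b b' : C) [ExactPairing b b'] (Y Z : C) :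
    ptr b b' ((α_ Y Z b).hom ≫ doubleBraiding Y (Z ⊗ b) ≫ (α_ Y Z b).inv) =
      encircle b b' Y ▷ Z ≫ doubleBraiding Y Z := by
  rw [doubleBraiding_tensor_right, ptr_whiskerRight_comp, ptr_comp_whiskerRight, ptr_whiskerLeft,
    ← BraidedCategory.braiding_naturality_left_assoc]
  rfl

/-- Two Yang–Baxter moves put one full turn of `b` on each side of the crossing, both around the
strand next to `b`. The other strand can then be closed freely. -/
theorem doubleBraiding_comp_braiding (b X : C) :
    (α_ b X X).hom ≫ doubleBraiding b (X ⊗ X) ≫ b ◁ (β_ X X).hom ≫ (α_ b X X).inv =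
      doubleBraiding b X ▷ X ≫ ((α_ b X X).hom ≫ b ◁ (β_ X X).hom ≫ (α_ b X X).inv) ≫
        doubleBraiding b X ▷ X := by
  calc
    _ = 𝟙 _ ⊗≫ (β_ b X).hom ▷ X ⊗≫ X ◁ (β_ b X).hom ⊗≫
        (X ◁ (β_ X b).hom ⊗≫ (β_ X b).hom ▷ X ⊗≫ b ◁ (β_ X X).hom) ⊗≫ 𝟙 _ := by
      rw [doubleBraiding, BraidedCategory.braiding_tensor_left_hom,
        BraidedCategory.braiding_tensor_right_hom]
      monoidal
    _ = 𝟙 _ ⊗≫ (β_ b X).hom ▷ X ⊗≫ (X ◁ (β_ b X).hom ⊗≫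
        (β_ X X).hom ▷ b ⊗≫ X ◁ (β_ X b).hom) ⊗≫ (β_ X b).hom ▷ X ⊗≫ 𝟙 _ := by
      have h : X ◁ (β_ X b).hom ⊗≫ (β_ X b).hom ▷ X ⊗≫ b ◁ (β_ X X).hom =
          𝟙 _ ⊗≫ ((β_ X X).hom ▷ b ⊗≫ X ◁ (β_ X b).hom ⊗≫ (β_ X b).hom ▷ X) ⊗≫ 𝟙 _ := by
        rw [BraidedCategory.yang_baxter']; monoidal
      rw [h]; monoidal
    _ = _ := by
      have h : X ◁ (β_ b X).hom ⊗≫ (β_ X X).hom ▷ b ⊗≫ X ◁ (β_ X b).hom =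
          𝟙 _ ⊗≫ ((β_ X b).hom ▷ X ⊗≫ b ◁ (β_ X X).hom ⊗≫ (β_ b X).hom ▷ X) ⊗≫ 𝟙 _ := by
        rw [BraidedCategory.yang_baxter']; monoidal
      rw [h, doubleBraiding]; monoidal

theorem Tr_encircle_braiding (b b' X W : C) [ExactPairing b b'] [ExactPairing X W] :
    Tr (X ⊗ X) (W ⊗ W) (encircle b b' (X ⊗ X) ≫ (β_ X X).hom) =
      Tr (b ⊗ X) (W ⊗ b') (b ◁ (twist X).hom ≫ doubleBraiding b X ≫ doubleBraiding b X) := by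
  -- Cyclicity of the trace carries `b` to the left of `X ⊗ X`, so that the last `X` can be traced
  -- out first.
  rw [encircle, ← ptr_comp_whiskerRight, ← Tr_tensor, doubleBraiding, Category.assoc,
    Tr_comm (b' ⊗ (W ⊗ W)) ((W ⊗ W) ⊗ b'), Category.assoc,
    BraidedCategory.braiding_naturality_left, ← Category.assoc]
  change Tr _ _ (doubleBraiding b (X ⊗ X) ≫ _) = _
  have h : doubleBraiding b (X ⊗ X) ≫ b ◁ (β_ X X).hom =
      (α_ b X X).inv ≫ ((α_ b X X).hom ≫ doubleBraiding b (X ⊗ X) ≫ b ◁ (β_ X X).hom) := by simp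
  rw [h, Tr_comm ((W ⊗ W) ⊗ b') (W ⊗ (W ⊗ b')), Category.assoc, Category.assoc,
    doubleBraiding_comp_braiding, Tr_tensor, ptr_whiskerRight_comp, ptr_comp_whiskerRight,
    ptr_whiskerLeft, ptr_braiding,
    doubleBraiding_naturality_right, ← doubleBraiding_naturality_right, ← Category.assoc, ← doubleBraiding_naturality_right,
    Category.assoc]

/-- Pulling the braided strand of `coevR` through `f` makes it cross both legs. The first crossing
cancels against the cap; a zigzag, the twist and the second crossing remain. -/
theorem rotation_formula (X W : C) [ExactPairing X W] (f : 𝟙_ C ⟶ X ⊗ X) :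
    coevR X W ≫ (W ◁ (λ_ X).inv) ≫ (W ◁ (f ▷ X)) ≫ (W ◁ (α_ X X X).hom) ≫
      (α_ W X (X ⊗ X)).inv ≫ (ε_ X W ▷ (X ⊗ X)) ≫ (λ_ (X ⊗ X)).hom =
    f ≫ (twist X).hom ▷ X ≫ (β_ X X).hom := by
  calc
    _ = 𝟙 _ ⊗≫ η_ X W ⊗≫ (twist X).hom ▷ W ⊗≫ (β_ X W).hom ⊗≫
        W ◁ ((β_ X (𝟙_ C)).hom ≫ f ▷ X) ⊗≫ ε_ X W ▷ (X ⊗ X) ⊗≫ 𝟙 _ := by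
      rw [coevR, braiding_tensorUnit_right, ← BraidedCategory.braiding_naturality_left]
      monoidal
    _ = 𝟙 _ ⊗≫ η_ X W ⊗≫ (twist X).hom ▷ W ⊗≫ (β_ X W).hom ▷ (𝟙_ C) ⊗≫
        W ◁ (X ◁ f ≫ (β_ X (X ⊗ X)).hom) ⊗≫ ε_ X W ▷ (X ⊗ X) ⊗≫ 𝟙 _ := by
      rw [BraidedCategory.braiding_naturality_right]; monoidal
    _ = 𝟙 _ ⊗≫ η_ X W ⊗≫ (twist X).hom ▷ W ⊗≫ ((β_ X W).hom ▷ (𝟙_ C) ≫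
        (W ⊗ X) ◁ f) ⊗≫ W ◁ (β_ X X).hom ▷ X ⊗≫
        ((W ⊗ X) ◁ (β_ X X).hom ≫ ε_ X W ▷ (X ⊗ X)) ⊗≫ 𝟙 _ := by
      rw [BraidedCategory.braiding_tensor_right_hom]; monoidal
    _ = 𝟙 _ ⊗≫ η_ X W ⊗≫ ((twist X).hom ▷ W ▷ (𝟙_ C) ≫ (X ⊗ W) ◁ f) ⊗≫
        ((β_ X W).hom ▷ X ⊗≫ W ◁ (β_ X X).hom ⊗≫ ε_ X W ▷ X) ▷ X ⊗≫ (β_ X X).hom ⊗≫ 𝟙 _ := by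
      rw [whisker_exchange (ε_ X W), ← whisker_exchange (β_ X W).hom]; monoidal
    _ = 𝟙 _ ⊗≫ (η_ X W ▷ (𝟙_ C) ≫ (X ⊗ W) ◁ f) ⊗≫ ((twist X).hom ▷ (W ⊗ X) ≫ X ◁ ε_ X W) ▷ X
        ⊗≫ (β_ X X).hom ⊗≫ 𝟙 _ := by
      rw [braiding_slide, ← whisker_exchange ((twist X).hom ▷ W) f]; monoidal
    _ = 𝟙 _ ⊗≫ f ⊗≫ (η_ X W ▷ X ⊗≫ X ◁ ε_ X W) ▷ X ⊗≫ (twist X).hom ▷ X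
        ⊗≫ (β_ X X).hom ⊗≫ 𝟙 _ := by
      rw [← whisker_exchange (η_ X W), ← whisker_exchange (twist X).hom]; monoidal
    _ = _ := by
      rw [evaluation_coevaluation'']; monoidal

end Encircling

/-! ### Schur's lemma, semisimple decompositions and multiplicities. -/

section Fusion

variable {C : Type u} [Category.{v} C] [Abelian C] [Linear ℂ C] [MonoidalCategory C]
  [MonoidalPreadditive C] [MonoidalLinear ℂ C] [RightRigidCategory C] [FusionCategory C]

theorem scalar_eq_of_smul_id {X : C} [Simple X] {f : X ⟶ X} {z : ℂ} (h : f = z • 𝟙 X) :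
    scalar f = z := by
  have h2 := scalar_smul_id f
  rw [h, ← sub_eq_zero, ← sub_smul, smul_eq_zero] at h2
  rw [h]
  exact sub_eq_zero.1 (h2.resolve_right (id_nonzero X))

@[simp]
theorem scalar_id (X : C) [Simple X] : scalar (𝟙 X) = 1 := scalar_eq_of_smul_id (by simp)

@[simp]
theorem scalar_zero (X : C) [Simple X] : scalar (0 : X ⟶ X) = 0 := scalar_eq_of_smul_id (by simp)

theorem scalar_add {X : C} [Simple X] (f g : X ⟶ X) : scalar (f + g) = scalar f + scalar g :=
  scalar_eq_of_smul_id (by rw [add_smul, scalar_smul_id, scalar_smul_id])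

theorem scalar_smul {X : C} [Simple X] (z : ℂ) (f : X ⟶ X) : scalar (z • f) = z * scalar f :=
  scalar_eq_of_smul_id (by rw [mul_smul, scalar_smul_id])

/-- `scalar` as a linear map. -/
def scalarLinear (X : C) [Simple X] : (X ⟶ X) →ₗ[ℂ] ℂ where
  toFun := scalar
  map_add' := scalar_add
  map_smul' := scalar_smul

theorem scalar_sum {X : C} [Simple X] {ι : Type*} (s : Finset ι) (f : ι → (X ⟶ X)) :
    scalar (∑ j ∈ s, f j) = ∑ j ∈ s, scalar (f j) :=
  map_sum (scalarLinear X) f s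

theorem Irr.eq_of_iso {b c : Irr C} (h : Nonempty (b.rep ≅ c.rep)) : b = c :=
  (Irr.existsUnique_iso c.rep).unique h ⟨Iso.refl _⟩

theorem Irr.hom_eq_zero {b c : Irr C} (h : b ≠ c) (f : b.rep ⟶ c.rep) : f = 0 := by
  by_contra hf
  have := isIso_of_hom_simple hf
  exact h (Irr.eq_of_iso ⟨asIso f⟩)

/-- The isomorphism class of a simple object. -/
def Irr.of (X : C) [Simple X] : Irr C := (Irr.existsUnique_iso X).exists.choose

/-- The isomorphism from the chosen representative. -/
def Irr.ofIso (X : C) [Simple X] : (Irr.of X).rep ≅ X :=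
  (Irr.existsUnique_iso X).exists.choose_spec.some

theorem Irr.of_eq {X : C} [Simple X] {b : Irr C} (h : Nonempty (b.rep ≅ X)) : Irr.of X = b :=
  (Irr.existsUnique_iso X).unique ⟨Irr.ofIso X⟩ h

/-- A decomposition of the identity of `V` along simple objects. -/
structure Resolution (V : C) where
  /-- the set of summands isomorphic to a given simple object -/
  ι : Irr C → Type
  [fintype : ∀ b, Fintype (ι b)]
  [decidableEq : ∀ b, DecidableEq (ι b)]
  /-- the projections -/
  p : ∀ b, ι b → (V ⟶ b.rep)
  /-- the inclusions -/
  i : ∀ b, ι b → (b.rep ⟶ V)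
  i_p : ∀ b j k, i b j ≫ p b k = if j = k then 𝟙 _ else 0
  sum_p_i : ∑ b, ∑ j, p b j ≫ i b j = 𝟙 V

attribute [instance] Resolution.fintype Resolution.decidableEq

open Classical in
theorem exists_resolution (V : C) : Nonempty (Resolution V) := by
  obtain ⟨n, S, hS, ⟨e⟩⟩ := FusionCategory.semisimple V
  let s : Fin n → Irr C := fun j => Irr.of (S j)
  let u : ∀ j, (s j).rep ≅ S j := fun j => Irr.ofIso (S j)
  -- Summands are grouped by the fibres of `s`; `eqToHom` identifies the representative of `s j`
  -- with that of `b`.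
  refine ⟨{
    ι := fun b => {j : Fin n // s j = b}
    p := fun b j => e.hom ≫ biproduct.π S j.1 ≫ (u j.1).inv ≫ eqToHom (by rw [j.2])
    i := fun b j => eqToHom (by rw [j.2]) ≫ (u j.1).hom ≫ biproduct.ι S j.1 ≫ e.inv
    i_p := ?_
    sum_p_i := ?_ }⟩
  · rintro b ⟨j, rfl⟩ ⟨k, hk⟩
    by_cases h : j = k
    · subst h
      simp
    · have h' : ¬ ((⟨j, rfl⟩ : {i : Fin n // s i = s j}) = ⟨k, hk⟩) := fun h2 =>
        h (congrArg Subtype.val h2)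
      simp [h', biproduct.ι_π_ne_assoc S h]
  · have key : ∀ b : Irr C, ∀ j : {j : Fin n // s j = b},
        (e.hom ≫ biproduct.π S j.1 ≫ (u j.1).inv ≫ eqToHom (by rw [j.2]) : V ⟶ b.rep) ≫
          eqToHom (by rw [j.2]) ≫ (u j.1).hom ≫ biproduct.ι S j.1 ≫ e.inv =
        e.hom ≫ (biproduct.π S j.1 ≫ biproduct.ι S j.1) ≫ e.inv := by
      rintro b ⟨j, rfl⟩
      simp
    simp only [key]
    rw [← Fintype.sum_sigma' (fun b (j : {j : Fin n // s j = b}) =>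
      e.hom ≫ (biproduct.π S j.1 ≫ biproduct.ι S j.1) ≫ e.inv)]
    refine ((Equiv.sigmaFiberEquiv s).sum_comp
      (fun j => e.hom ≫ (biproduct.π S j ≫ biproduct.ι S j) ≫ e.inv)).trans ?_
    rw [← Preadditive.comp_sum, ← Preadditive.sum_comp, biproduct.total]
    simp

/-- A chosen decomposition. -/
def resolution (V : C) : Resolution V := (exists_resolution V).some

namespace Resolution

variable {V : C} (R : Resolution V)

theorem sum_i (b : Irr C) (f : b.rep ⟶ V) : ∑ j, scalar (f ≫ R.p b j) • R.i b j = f := by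
  conv_rhs => rw [← Category.comp_id f, ← R.sum_p_i, Preadditive.comp_sum]
  rw [Finset.sum_eq_single b]
  · rw [Preadditive.comp_sum]
    refine Finset.sum_congr rfl fun j _ => ?_
    conv_rhs => rw [← Category.assoc, ← scalar_smul_id (f ≫ R.p b j)]
    simp
  · intro c _ hc
    rw [Preadditive.comp_sum]
    refine Finset.sum_eq_zero fun j _ => ?_
    rw [← Category.assoc, Irr.hom_eq_zero hc.symm (f ≫ _), zero_comp]
  · simp

theorem sum_p (b : Irr C) (g : V ⟶ b.rep) : ∑ j, scalar (R.i b j ≫ g) • R.p b j = g := by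
  conv_rhs => rw [← Category.id_comp g, ← R.sum_p_i, Preadditive.sum_comp]
  rw [Finset.sum_eq_single b]
  · rw [Preadditive.sum_comp]
    refine Finset.sum_congr rfl fun j _ => ?_
    conv_rhs => rw [Category.assoc, ← scalar_smul_id (R.i b j ≫ g)]
    simp
  · intro c _ hc
    rw [Preadditive.sum_comp]
    refine Finset.sum_eq_zero fun j _ => ?_
    rw [Category.assoc, Irr.hom_eq_zero hc (_ ≫ g), comp_zero]
  · simp

/-- The inclusions form a basis. -/
def basisI (b : Irr C) : Module.Basis (R.ι b) ℂ (b.rep ⟶ V) :=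
  Module.Basis.ofEquivFun
    { toFun := fun f j => scalar (f ≫ R.p b j)
      invFun := fun z => ∑ j, z j • R.i b j
      map_add' := fun f g => by ext j; simp [scalar_add]
      map_smul' := fun z f => by ext j; simp [scalar_smul]
      left_inv := fun f => R.sum_i b f
      right_inv := fun z => by
        ext j
        simp only [Preadditive.sum_comp, Linear.smul_comp, R.i_p, scalar_sum, scalar_smul]
        rw [Finset.sum_eq_single j] <;> simp +contextual }

/-- The projections form a basis. -/
def basisP (b : Irr C) : Module.Basis (R.ι b) ℂ (V ⟶ b.rep) :=
  Module.Basis.ofEquivFun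
    { toFun := fun f j => scalar (R.i b j ≫ f)
      invFun := fun z => ∑ j, z j • R.p b j
      map_add' := fun f g => by ext j; simp [scalar_add]
      map_smul' := fun z f => by ext j; simp [scalar_smul]
      left_inv := fun f => R.sum_p b f
      right_inv := fun z => by
        ext j
        simp only [Preadditive.comp_sum, Linear.comp_smul, R.i_p, scalar_sum, scalar_smul]
        rw [Finset.sum_eq_single j] <;> simp +contextual [eq_comm] }

theorem card_eq_finrank_from (b : Irr C) :
    Fintype.card (R.ι b) = Module.finrank ℂ (b.rep ⟶ V) :=
  (Module.finrank_eq_card_basis (R.basisI b)).symm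

theorem card_eq_finrank_to (b : Irr C) :
    Fintype.card (R.ι b) = Module.finrank ℂ (V ⟶ b.rep) :=
  (Module.finrank_eq_card_basis (R.basisP b)).symm

theorem trace_rightComp (b : Irr C) (f : V ⟶ V) :
    LinearMap.trace ℂ (b.rep ⟶ V) (Linear.rightComp ℂ b.rep f) =
      ∑ j, scalar (R.i b j ≫ f ≫ R.p b j) := by
  rw [LinearMap.trace_eq_matrix_trace ℂ (R.basisI b), Matrix.trace]
  refine Finset.sum_congr rfl fun j _ => ?_
  have h : R.basisI b j = R.i b j := by
    simp only [basisI, Module.Basis.coe_ofEquivFun]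
    change ∑ k, _ • _ = _
    rw [Finset.sum_eq_single j] <;> simp +contextual
  rw [Matrix.diag_apply, LinearMap.toMatrix_apply, h]
  change scalar ((R.i b j ≫ f) ≫ R.p b j) = _
  rw [Category.assoc]

end Resolution

theorem finrank_hom_comm (b : Irr C) (V : C) :
    Module.finrank ℂ (b.rep ⟶ V) = Module.finrank ℂ (V ⟶ b.rep) := by
  rw [← (resolution V).card_eq_finrank_from, (resolution V).card_eq_finrank_to]

theorem finrank_congr_left {X X' : C} (e : X ≅ X') (Y : C) :
    Module.finrank ℂ (X ⟶ Y) = Module.finrank ℂ (X' ⟶ Y) :=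
  (Linear.homCongr ℂ e (Iso.refl Y)).finrank_eq

theorem finrank_congr_right (X : C) {Y Y' : C} (e : Y ≅ Y') :
    Module.finrank ℂ (X ⟶ Y) = Module.finrank ℂ (X ⟶ Y') :=
  (Linear.homCongr ℂ (Iso.refl X) e).finrank_eq

theorem finrank_hom_comm_simple (X : C) [Simple X] (V : C) :
    Module.finrank ℂ (X ⟶ V) = Module.finrank ℂ (V ⟶ X) := by
  rw [← finrank_congr_left (Irr.ofIso X), finrank_hom_comm, finrank_congr_right _ (Irr.ofIso X)]

/-- `tensorLeftHomEquiv` as a linear equivalence. -/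
def tensorLeftLinearEquiv (X Y Y' Z : C) [ExactPairing Y Y'] :
    (Y' ⊗ X ⟶ Z) ≃ₗ[ℂ] (X ⟶ Y ⊗ Z) :=
  { tensorLeftHomEquiv X Y Y' Z with
    map_add' := fun f g => by
      simp [tensorLeftHomEquiv, MonoidalPreadditive.whiskerLeft_add]
    map_smul' := fun z f => by
      simp [tensorLeftHomEquiv, MonoidalLinear.whiskerLeft_smul] }

theorem finrank_tensorLeft (X Y Y' Z : C) [ExactPairing Y Y'] :
    Module.finrank ℂ (Y' ⊗ X ⟶ Z) = Module.finrank ℂ (X ⟶ Y ⊗ Z) :=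
  (tensorLeftLinearEquiv X Y Y' Z).finrank_eq

theorem finrank_tensorRight (X Y Y' Z : C) [ExactPairing Y Y'] :
    Module.finrank ℂ (X ⊗ Y ⟶ Z) = Module.finrank ℂ (X ⟶ Z ⊗ Y') :=
  LinearEquiv.finrank_eq
    { tensorRightHomEquiv X Y Y' Z with
      map_add' := fun f g => by
        simp [tensorRightHomEquiv, MonoidalPreadditive.add_whiskerRight]
      map_smul' := fun z f => by
        simp [tensorRightHomEquiv, MonoidalLinear.smul_whiskerRight] }

/-- The idempotent of any simple summand is a nonzero multiple of the identity, so that summand is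
all of `V`. -/
theorem simple_of_finrank_end_eq_one {V : C} (h : Module.finrank ℂ (V ⟶ V) = 1) : Simple V := by
  obtain ⟨n, S, hS, ⟨e⟩⟩ := FusionCategory.semisimple V
  have hV : 𝟙 V ≠ 0 := by
    intro h0
    have : Subsingleton (V ⟶ V) := ⟨fun f g => by
      rw [← Category.id_comp f, ← Category.id_comp g, h0, zero_comp, zero_comp]⟩
    rw [Module.finrank_zero_of_subsingleton] at h
    exact zero_ne_one h
  have hn : 0 < n := by
    rcases Nat.eq_zero_or_pos n with rfl | hn
    · exfalso
      apply hV
      rw [← e.hom_inv_id, ← Category.id_comp e.inv, ← biproduct.total]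
      simp
    · exact hn
  let j : Fin n := ⟨0, hn⟩
  have := hS j
  obtain ⟨z, hz⟩ := (finrank_eq_one_iff_of_nonzero' (𝟙 V) hV).1 h
    (e.hom ≫ biproduct.π S j ≫ biproduct.ι S j ≫ e.inv)
  have hz0 : z ≠ 0 := by
    rintro rfl
    apply id_nonzero (S j)
    calc 𝟙 (S j) = biproduct.ι S j ≫ e.inv ≫
          (e.hom ≫ biproduct.π S j ≫ biproduct.ι S j ≫ e.inv) ≫ e.hom ≫ biproduct.π S j := by simp
      _ = 0 := by rw [← hz]; simp
  refine Simple.of_iso (Y := S j) ⟨e.hom ≫ biproduct.π S j,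
    z⁻¹ • (biproduct.ι S j ≫ e.inv), ?_, ?_⟩
  · rw [Linear.comp_smul, Category.assoc, ← hz, smul_smul, inv_mul_cancel₀ hz0, one_smul]
  · have h2 : z • (biproduct.ι S j ≫ e.inv) = biproduct.ι S j ≫ e.inv := by
      calc _ = biproduct.ι S j ≫ e.inv ≫ (z • 𝟙 V) := by simp
        _ = _ := by rw [hz]; simp
    rw [← h2, smul_smul, inv_mul_cancel₀ hz0, one_smul]
    simp

instance simple_rightDual (X : C) [Simple X] : Simple (Xᘁ) := by
  apply simple_of_finrank_end_eq_one
  -- `End(X*) ≅ Hom(𝟙, X ⊗ X*) ≅ End(X)`.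
  rw [finrank_congr_left (ρ_ Xᘁ).symm, finrank_tensorLeft (𝟙_ C) X Xᘁ Xᘁ,
    ← finrank_tensorRight (𝟙_ C) X Xᘁ X, finrank_congr_left (λ_ X)]
  exact finrank_endomorphism_simple_eq_one ℂ X

end Fusion

/-! ### Quantum traces, dimensions and nonvanishing of the global dimension. -/

section Trace

variable {C : Type u} [Category.{v} C] [Abelian C] [Linear ℂ C] [MonoidalCategory C]
  [MonoidalPreadditive C] [MonoidalLinear ℂ C] [RightRigidCategory C] [BraidedCategory C]
  [RibbonCategory C] [FusionCategory C]

/-- The partial trace as a linear map. -/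
@[simps]
def ptrLinear (V W P Q : C) [ExactPairing V W] : (P ⊗ V ⟶ Q ⊗ V) →ₗ[ℂ] (P ⟶ Q) where
  toFun f := ptr V W f
  map_add' f g := by simp [ptr, MonoidalPreadditive.add_whiskerRight]
  map_smul' z f := by simp [ptr, MonoidalLinear.smul_whiskerRight]

/-- Whiskering on the left as a linear map. -/
@[simps]
def whiskerLeftLinear (P V V' : C) : (V ⟶ V') →ₗ[ℂ] (P ⊗ V ⟶ P ⊗ V') where
  toFun f := P ◁ f
  map_add' f g := by simp [MonoidalPreadditive.whiskerLeft_add]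
  map_smul' z f := by simp [MonoidalLinear.whiskerLeft_smul]

/-- Whiskering on the right as a linear map. -/
@[simps]
def whiskerRightLinear (V V' P : C) : (V ⟶ V') →ₗ[ℂ] (V ⊗ P ⟶ V' ⊗ P) where
  toFun f := f ▷ P
  map_add' f g := by simp [MonoidalPreadditive.add_whiskerRight]
  map_smul' z f := by simp [MonoidalLinear.smul_whiskerRight]

/-- Cyclicity against the identity shows independence of the chosen dual. -/
theorem qtrace_eq (V W : C) [ExactPairing V W] (f : V ⟶ V) : qtrace f = scalar (Tr V W f) := by
  have := Tr_comm Vᘁ W f (𝟙 V)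
  rw [Category.comp_id, Category.id_comp] at this
  rw [← this]
  rfl

theorem qtrace_comm {V V' : C} (f : V ⟶ V') (g : V' ⟶ V) : qtrace (f ≫ g) = qtrace (g ≫ f) := by
  rw [qtrace_eq V Vᘁ, qtrace_eq V' V'ᘁ, Tr_comm _ V'ᘁ]

/-- The trace as a linear map. -/
def qtraceLinear (V : C) : (V ⟶ V) →ₗ[ℂ] ℂ where
  toFun := qtrace
  map_add' f g := by simp [qtrace, MonoidalPreadditive.add_whiskerRight, scalar_add]
  map_smul' z f := by simp [qtrace, MonoidalLinear.smul_whiskerRight, scalar_smul]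

theorem qtrace_sum {V : C} {ι : Type*} (s : Finset ι) (f : ι → (V ⟶ V)) :
    qtrace (∑ j ∈ s, f j) = ∑ j ∈ s, qtrace (f j) :=
  map_sum (qtraceLinear V) f s

theorem qtrace_smul {V : C} (z : ℂ) (f : V ⟶ V) : qtrace (z • f) = z * qtrace f :=
  map_smul (qtraceLinear V) z f

theorem qtrace_simple {X : C} [Simple X] (f : X ⟶ X) : qtrace f = scalar f * dim X := by
  conv_lhs => rw [← scalar_smul_id f, qtrace_smul]
  rfl

theorem dim_congr {X Y : C} (e : X ≅ Y) : dim X = dim Y := by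
  rw [dim, ← e.hom_inv_id, qtrace_comm, e.inv_hom_id, dim]

theorem dim_unit : dim (𝟙_ C) = 1 := by
  rw [dim, qtrace_eq (𝟙_ C) (𝟙_ C)]
  have : Tr (𝟙_ C) (𝟙_ C) (𝟙 (𝟙_ C)) = 𝟙 (𝟙_ C) := by
    rw [Tr, evR, twist_unit, braiding_tensorUnit_right]
    change (ρ_ (𝟙_ C)).inv ≫ _ ≫ _ ≫ _ ≫ (ρ_ (𝟙_ C)).hom = _
    monoidal
  rw [this, scalar_id]

theorem dim_rightDual (X : C) : dim Xᘁ = dim X := by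
  let := reversePairing X Xᘁ
  rw [dim, qtrace_eq Xᘁ X, Tr_reverse, dim, qtrace_eq X Xᘁ, Tr]
  simp

theorem dim_tensor (V₁ V₂ : C) [Simple V₁] [Simple V₂] :
    dim (V₁ ⊗ V₂) = dim V₁ * dim V₂ := by
  rw [dim, qtrace_eq (V₁ ⊗ V₂) (V₂ᘁ ⊗ V₁ᘁ), Tr_tensor]
  have h : ptr V₂ V₂ᘁ (𝟙 (V₁ ⊗ V₂)) = dim V₂ • 𝟙 V₁ := by
    rw [← whiskerLeft_id, ptr_whiskerLeft_end, ← scalar_smul_id (Tr V₂ V₂ᘁ (𝟙 V₂)),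
      MonoidalLinear.whiskerLeft_smul]
    simp [dim, qtrace_eq V₂ V₂ᘁ]
  rw [h, ← qtrace_eq, qtrace_smul, mul_comm]
  rfl

theorem qtrace_resolution {V : C} (R : Resolution V) (f : V ⟶ V) :
    qtrace f = ∑ b, dim b.rep * ∑ j, scalar (R.i b j ≫ f ≫ R.p b j) := by
  conv_lhs => rw [← Category.id_comp f, ← R.sum_p_i]
  simp only [Preadditive.sum_comp, qtrace_sum, Finset.mul_sum]
  refine Finset.sum_congr rfl fun b _ => Finset.sum_congr rfl fun j _ => ?_
  rw [Category.assoc, qtrace_comm, qtrace_simple, Category.assoc, mul_comm]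

theorem qtrace_eq_sum_trace {V : C} (f : V ⟶ V) :
    qtrace f = ∑ b : Irr C, dim b.rep *
      LinearMap.trace ℂ (b.rep ⟶ V) (Linear.rightComp ℂ b.rep f) := by
  rw [qtrace_resolution (resolution V)]
  simp only [(resolution V).trace_rightComp]

theorem dim_eq_sum (V : C) :
    dim V = ∑ b : Irr C, (Module.finrank ℂ (V ⟶ b.rep) : ℂ) * dim b.rep := by
  rw [dim, qtrace_resolution (resolution V)]
  refine Finset.sum_congr rfl fun b _ => ?_
  simp [(resolution V).i_p, ← (resolution V).card_eq_finrank_to, mul_comm]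

theorem sum_fusionCoeff_dim (b c : Irr C) :
    ∑ a : Irr C, (fusionCoeff b.rep c.rep a.rep : ℂ) * dim a.rep = dim b.rep * dim c.rep := by
  rw [← dim_tensor, dim_eq_sum]
  rfl

theorem sum_finrank_dim (X Y : C) [Simple X] [Simple Y] :
    ∑ a : Irr C, (Module.finrank ℂ (X ⊗ Y ⟶ a.rep) : ℂ) * dim a.rep = dim X * dim Y := by
  rw [← dim_tensor, dim_eq_sum]

theorem finrank_dual_tensor (b c a : Irr C) :
    Module.finrank ℂ ((b.rep)ᘁ ⊗ a.rep ⟶ c.rep) = fusionCoeff b.rep c.rep a.rep := by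
  rw [finrank_tensorLeft a.rep b.rep, finrank_hom_comm]
  rfl

-- Multiplication by `a` and by `a*` are adjoint: `∑ N_{ab}^c d_c conj(d_b)` is `d_a ∑ |d_b|²` when
-- summed over `c` first and `conj(d_a) ∑ |d_b|²` when summed over `b` first. The common factor is
-- positive because `d_𝟙 = 1`.
open ComplexConjugate in
theorem conj_dim (a : Irr C) : conj (dim a.rep) = dim a.rep := by
  let N : ℂ := ∑ b : Irr C, dim b.rep * conj (dim b.rep)
  have h1 : ∑ b : Irr C, ∑ c : Irr C, (fusionCoeff a.rep b.rep c.rep : ℂ) * dim c.rep *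
      conj (dim b.rep) = dim a.rep * N := by
    simp only [← Finset.sum_mul, sum_fusionCoeff_dim]
    simp only [N, Finset.mul_sum, mul_assoc]
  have h2 : ∑ b : Irr C, ∑ c : Irr C, (fusionCoeff a.rep b.rep c.rep : ℂ) * dim c.rep *
      conj (dim b.rep) = conj (dim a.rep) * N := by
    rw [Finset.sum_comm, Finset.mul_sum]
    refine Finset.sum_congr rfl fun c _ => ?_
    have h := congrArg conj (sum_finrank_dim (a.rep)ᘁ c.rep)
    rw [dim_rightDual, map_mul, map_sum] at h
    calc _ = dim c.rep * ∑ b : Irr C, (fusionCoeff a.rep b.rep c.rep : ℂ) *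
          conj (dim b.rep) := by
          rw [Finset.mul_sum]
          exact Finset.sum_congr rfl fun b _ => by ring
      _ = dim c.rep * (conj (dim a.rep) * conj (dim c.rep)) := by
          rw [← h]
          congr 1
          refine Finset.sum_congr rfl fun b _ => ?_
          rw [finrank_dual_tensor, map_mul, Complex.conj_natCast]
      _ = _ := by ring
  have hN : N ≠ 0 := by
    have : N = ((∑ b : Irr C, Complex.normSq (dim b.rep) : ℝ) : ℂ) := by
      simp [N, Complex.mul_conj]
    rw [this, Complex.ofReal_ne_zero]
    refine (Finset.sum_pos' (fun b _ => Complex.normSq_nonneg _)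
      ⟨Irr.of (𝟙_ C), Finset.mem_univ _, ?_⟩).ne'
    rw [dim_congr (Irr.ofIso (𝟙_ C)), dim_unit]
    simp
  exact mul_right_cancel₀ hN (h2.symm.trans h1)

theorem globalDim_ne_zero : globalDim C ≠ 0 := by
  have : globalDim C = ((∑ b : Irr C, Complex.normSq (dim b.rep) : ℝ) : ℂ) := by
    rw [globalDim]
    push_cast
    refine Finset.sum_congr rfl fun b _ => ?_
    rw [Complex.normSq_eq_conj_mul_self, conj_dim, sq]
  rw [this, Complex.ofReal_ne_zero]
  refine (Finset.sum_pos' (fun b _ => Complex.normSq_nonneg _)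
    ⟨Irr.of (𝟙_ C), Finset.mem_univ _, ?_⟩).ne'
  rw [dim_congr (Irr.ofIso (𝟙_ C)), dim_unit]
  simp

/-- The dual of an isomorphism class of simple objects. -/
def Irr.dual (b : Irr C) : Irr C := Irr.of (b.rep)ᘁ

/-- Isomorphic objects have isomorphic duals. -/
def rightDualIsoOfIso {X Y : C} (e : X ≅ Y) : Xᘁ ≅ Yᘁ :=
  let := exactPairingCongrLeft (Y := Yᘁ) e
  rightDualIso inferInstance this

theorem Irr.dual_dual (b : Irr C) : b.dual.dual = b := by
  let := reversePairing b.rep (b.rep)ᘁ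
  exact Irr.of_eq ⟨rightDualIso this inferInstance ≪≫
    rightDualIsoOfIso (Irr.ofIso (b.rep)ᘁ).symm⟩

theorem dim_dual (b : Irr C) : dim b.dual.rep = dim b.rep := by
  rw [Irr.dual, dim_congr (Irr.ofIso (b.rep)ᘁ), dim_rightDual]

theorem twistScalar_congr {X Y : C} [Simple X] [Simple Y] (e : X ≅ Y) :
    twistScalar X = twistScalar Y := by
  apply scalar_eq_of_smul_id
  rw [← cancel_mono e.hom, ← twist_naturality, ← scalar_smul_id (twist Y).hom]
  simp [twistScalar]

theorem twistScalar_rightDual (X : C) [Simple X] : twistScalar Xᘁ = twistScalar X := by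
  apply scalar_eq_of_smul_id
  rw [twist_dual, ← scalar_smul_id (twist X).hom]
  have h : ((scalar (twist X).hom • 𝟙 X : X ⟶ X)ᘁ : Xᘁ ⟶ Xᘁ) =
      scalar (twist X).hom • ((𝟙 X : X ⟶ X)ᘁ : Xᘁ ⟶ Xᘁ) := by
    simp only [rightAdjointMate, MonoidalLinear.smul_whiskerRight,
      MonoidalLinear.whiskerLeft_smul, Linear.smul_comp, Linear.comp_smul]
  rw [h, rightAdjointMate_id]
  rfl

theorem twistScalar_dual (b : Irr C) : twistScalar b.dual.rep = twistScalar b.rep := by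
  rw [Irr.dual, twistScalar_congr (Irr.ofIso (b.rep)ᘁ), twistScalar_rightDual]

theorem twistScalar_ne_zero (X : C) [Simple X] : twistScalar X ≠ 0 := by
  intro h
  apply id_nonzero X
  rw [← (twist X).hom_inv_id, ← scalar_smul_id (twist X).hom]
  change (twistScalar X • 𝟙 X) ≫ _ = 0
  rw [h]
  simp

end Trace

/-! ### The Kirby colour, handle slides and the killing property. -/

section Kirby

variable {C : Type u} [Category.{v} C] [Abelian C] [Linear ℂ C] [MonoidalCategory C]
  [MonoidalPreadditive C] [MonoidalLinear ℂ C] [RightRigidCategory C] [BraidedCategory C]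
  [RibbonCategory C] [FusionCategory C]

/-- Both sides are the trace of `I ≫ J` on `W ⊗ c`: one by cyclicity, the other by closing `W` on
the left before `c`. -/
theorem dim_mul_scalar_bend (V W b c : C) [ExactPairing V W] [Simple b] [Simple c]
    (I : W ⊗ c ⟶ b) (J : b ⟶ W ⊗ c) :
    letI := reversePairing V W
    dim b * scalar (J ≫ I) = dim c * scalar (tensorLeftLinearEquiv c V W b I ≫
      (tensorLeftLinearEquiv b W V c).symm J) := by
  let := reversePairing V W
  rw [mul_comm, ← qtrace_simple, qtrace_comm, mul_comm, ← qtrace_simple,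
    qtrace_eq (W ⊗ c) (cᘁ ⊗ V), ← Tr_leftTrace, ← qtrace_eq]
  congr 1
  change _ = ((λ_ c).inv ≫ η_ V W ▷ c ≫ (α_ V W c).hom ≫ V ◁ I) ≫
    V ◁ J ≫ (α_ V W c).inv ≫ evR V W ▷ c ≫ (λ_ c).hom
  simp

/-- Dual bases of `Hom(V ⊗ b, c)` and `Hom(c, V ⊗ b)` become, after bending `V`, dual bases up
to the ratio of the dimensions. -/
theorem dim_smul_sum_bend (V W : C) [ExactPairing V W] (b c : Irr C) (R : Resolution (V ⊗ b.rep))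
    (S : Resolution (W ⊗ c.rep)) :
    letI := reversePairing V W
    dim b.rep • ∑ j, (tensorLeftLinearEquiv c.rep V W b.rep).symm (R.i c j) ≫
        tensorLeftLinearEquiv b.rep W V c.rep (R.p c j) =
      dim c.rep • ∑ k, S.p b k ≫ S.i b k := by
  let := reversePairing V W
  -- Expanding bent inclusions in `S.p`, and `S.i` in bent projections, yields the same products on
  -- both sides; `dim_mul_scalar_bend` matches the coefficients.
  have hl : ∀ j, (tensorLeftLinearEquiv c.rep V W b.rep).symm (R.i c j) =
      ∑ k, scalar (S.i b k ≫ (tensorLeftLinearEquiv c.rep V W b.rep).symm (R.i c j)) • S.p b k :=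
    fun j => (S.sum_p b _).symm
  have hr : ∀ k, S.i b k = ∑ j, scalar (R.i c j ≫
      (tensorLeftLinearEquiv b.rep W V c.rep).symm (S.i b k)) •
        tensorLeftLinearEquiv b.rep W V c.rep (R.p c j) := by
    intro k
    have h := congrArg (tensorLeftLinearEquiv b.rep W V c.rep)
      (R.sum_p c ((tensorLeftLinearEquiv b.rep W V c.rep).symm (S.i b k)))
    rw [LinearEquiv.apply_symm_apply, map_sum] at h
    simpa only [map_smul] using h.symm
  conv_lhs => enter [2, 2, j]; rw [hl j]
  conv_rhs => enter [2, 2, k]; rw [hr k]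
  simp only [Preadditive.sum_comp, Preadditive.comp_sum, Finset.smul_sum, Linear.smul_comp,
    Linear.comp_smul, smul_smul]
  rw [Finset.sum_comm]
  refine Finset.sum_congr rfl fun k _ => Finset.sum_congr rfl fun j _ => ?_
  rw [dim_mul_scalar_bend V W b.rep c.rep, LinearEquiv.apply_symm_apply]

/-- The Kirby-coloured loop around `Y`. -/
def kirby (Y : C) : Y ⟶ Y := ∑ b : Irr C, dim b.rep • encircle b.rep (b.rep)ᘁ Y

theorem kirby_naturality {Y Y' : C} (f : Y ⟶ Y') : f ≫ kirby Y' = kirby Y ≫ f := by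
  simp only [kirby, Preadditive.comp_sum, Preadditive.sum_comp, Linear.comp_smul,
    Linear.smul_comp, encircle_naturality]

/-- The partial trace over `W ⊗ c` of an endomorphism of `W ⊗ c` composed with a double braiding
of `Y` and `c`, where `W` turns back to its dual `Z`. -/
def loopOperator (Y Z W c : C) [ExactPairing Z W] :
    (W ⊗ c ⟶ W ⊗ c) →ₗ[ℂ] (Y ⊗ Z ⟶ Y ⊗ Z) :=
  letI := reversePairing Z W
  ptrLinear (W ⊗ c) (cᘁ ⊗ Z) (Y ⊗ Z) (Y ⊗ Z) ∘ₗ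
    Linear.leftComp ℂ _
      (((α_ Y Z (W ⊗ c)).hom ≫ Y ◁ ((α_ Z W c).inv ≫ evR Z W ▷ c ≫ (λ_ c).hom)) ≫
        doubleBraiding Y c ≫
        Y ◁ ((λ_ c).inv ≫ η_ Z W ▷ c ≫ (α_ Z W c).hom) ≫ (α_ Y Z (W ⊗ c)).inv) ∘ₗ
    whiskerLeftLinear (Y ⊗ Z) (W ⊗ c) (W ⊗ c)

theorem loopOperator_id (Y Z W c : C) [ExactPairing Z W] :
    loopOperator Y Z W c (𝟙 _) = encircle c cᘁ Y ▷ Z := by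
  let := reversePairing Z W
  rw [encircle, ← ptr_slide Z W]
  change ptr _ _ (_ ≫ (Y ⊗ Z) ◁ 𝟙 (W ⊗ c)) = _
  rw [whiskerLeft_id, Category.comp_id]

/-- Writing `p` and `i` through their bent forms and sliding one around the loop replaces the loop
`b` by a loop `W ⊗ c` in which only `c` links `Y`. -/
theorem ptr_doubleBraiding_resolution (Y Z W : C) [ExactPairing Z W] (b c : C)
    (p : Z ⊗ b ⟶ c) (i : c ⟶ Z ⊗ b) :
    letI := reversePairing Z W
    ptr b bᘁ ((α_ Y Z b).hom ≫ (Y ◁ p ≫ doubleBraiding Y c ≫ Y ◁ i) ≫ (α_ Y Z b).inv) =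
      loopOperator Y Z W c
        ((tensorLeftLinearEquiv c Z W b).symm i ≫ tensorLeftLinearEquiv b W Z c p) := by
  let := reversePairing Z W
  have hp : p = Z ◁ (tensorLeftLinearEquiv b W Z c p) ≫ (α_ Z W c).inv ≫ evR Z W ▷ c ≫
      (λ_ c).hom := ((tensorLeftLinearEquiv b W Z c).symm_apply_apply p).symm
  have hi : i = (λ_ c).inv ≫ η_ Z W ▷ c ≫ (α_ Z W c).hom ≫
      Z ◁ (tensorLeftLinearEquiv c Z W b).symm i :=
    ((tensorLeftLinearEquiv c Z W b).apply_symm_apply i).symm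
  generalize tensorLeftLinearEquiv b W Z c p = P at *
  generalize (tensorLeftLinearEquiv c Z W b).symm i = I at *
  subst hp hi
  change _ = ptr (W ⊗ c) (cᘁ ⊗ Z) (_ ≫ (Y ⊗ Z) ◁ (I ≫ P))
  conv_rhs => rw [whiskerLeft_comp (Y ⊗ Z) I P, ← Category.assoc, ← ptr_dinatural b bᘁ]
  congr 1
  simp

theorem encircle_whiskerRight_doubleBraiding (b Y Z W : C) [ExactPairing Z W]
    (R : Resolution (Z ⊗ b)) :
    letI := reversePairing Z W
    encircle b bᘁ Y ▷ Z ≫ doubleBraiding Y Z = ∑ c : Irr C, ∑ j, loopOperator Y Z W c.rep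
      ((tensorLeftLinearEquiv c.rep Z W b).symm (R.i c j) ≫
        tensorLeftLinearEquiv b W Z c.rep (R.p c j)) := by
  let := reversePairing Z W
  have h : (α_ Y Z b).hom ≫ doubleBraiding Y (Z ⊗ b) ≫ (α_ Y Z b).inv =
      ∑ c : Irr C, ∑ j, (α_ Y Z b).hom ≫
        (Y ◁ R.p c j ≫ doubleBraiding Y c.rep ≫ Y ◁ R.i c j) ≫ (α_ Y Z b).inv := by
    simp only [← doubleBraiding_naturality_right, ← whiskerLeft_comp_assoc]
    simp only [← Preadditive.comp_sum, ← Preadditive.sum_comp]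
    congr 1
    have h1 : ∑ c : Irr C, ∑ j, Y ◁ (R.p c j ≫ R.i c j) = 𝟙 (Y ⊗ (Z ⊗ b)) := by
      rw [← whiskerLeft_id, ← R.sum_p_i]
      simp only [← whiskerLeftLinear_apply, map_sum]
    rw [h1, Category.id_comp]
  rw [← ptr_doubleBraiding_tensor, h]
  simp only [← ptr_doubleBraiding_resolution]
  simp only [← ptrLinear_apply, map_sum]

/-- Handle slide: decomposing `Z ⊗ b` recolours the loop by `c`, with `Z` bent back along it. The
weights `d_b` are exactly what makes the sum over `b` an identity on `Zᘁ ⊗ c`, after which `Z`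
straightens, unlinked from `Y`. -/
theorem kirby_whiskerRight (Y Z : C) :
    kirby Y ▷ Z ≫ doubleBraiding Y Z = kirby Y ▷ Z := by
  let := reversePairing Z Zᘁ
  let R : ∀ b : Irr C, Resolution (Z ⊗ b.rep) := fun b => resolution _
  let S : ∀ c : Irr C, Resolution (Zᘁ ⊗ c.rep) := fun b => resolution _
  have hk : kirby Y ▷ Z = ∑ b : Irr C, dim b.rep • encircle b.rep (b.rep)ᘁ Y ▷ Z := by
    simp only [kirby, ← whiskerRightLinear_apply, map_sum, map_smul]
  rw [hk, Preadditive.sum_comp]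
  simp only [Linear.smul_comp]
  calc
    _ = ∑ c : Irr C, ∑ b : Irr C, loopOperator Y Z Zᘁ c.rep (dim b.rep • ∑ j,
        ((tensorLeftLinearEquiv c.rep Z Zᘁ b.rep).symm ((R b).i c j) ≫
          tensorLeftLinearEquiv b.rep Zᘁ Z c.rep ((R b).p c j))) := by
      rw [Finset.sum_comm]
      refine Finset.sum_congr rfl fun b _ => ?_
      rw [encircle_whiskerRight_doubleBraiding b.rep Y Z Zᘁ (R b), Finset.smul_sum]
      simp only [map_smul, map_sum]
    _ = ∑ c : Irr C, dim c.rep • loopOperator Y Z Zᘁ c.rep (𝟙 _) := by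
      refine Finset.sum_congr rfl fun c _ => ?_
      -- The weight `d_b` turns into `d_c`, which no longer depends on `b`, so the sum over `b`
      -- resolves the identity.
      simp only [dim_smul_sum_bend Z Zᘁ _ c _ (S c)]
      rw [← map_sum, ← Finset.smul_sum, (S c).sum_p_i, map_smul]
    _ = _ := by
      simp only [loopOperator_id]

theorem encircle_of_isTransparent {Y : C} [Simple Y] (hY : IsTransparent Y) (b : C) [Simple b] :
    encircle b bᘁ Y = dim b • 𝟙 Y := by
  have h : doubleBraiding Y b = Y ◁ 𝟙 b := by rw [whiskerLeft_id]; exact hY b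
  rw [encircle, h, ptr_whiskerLeft_end, ← scalar_smul_id (Tr b bᘁ (𝟙 b)),
    MonoidalLinear.whiskerLeft_smul]
  simp [dim, qtrace_eq b bᘁ]

theorem kirby_of_isTransparent {Y : C} [Simple Y] (hY : IsTransparent Y) :
    kirby Y = globalDim C • 𝟙 Y := by
  simp only [kirby, encircle_of_isTransparent hY, smul_smul, globalDim, Finset.sum_smul, sq]

/-- By Schur a nonzero Kirby loop on `Y` is invertible, and cancelling it in the handle slide
trivialises every double braiding with `Y`. -/
theorem kirby_of_not_isTransparent {Y : C} [Simple Y] (hY : ¬ IsTransparent Y) :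
    kirby Y = 0 := by
  by_contra h0
  apply hY
  intro Z
  have h := kirby_whiskerRight Y Z
  have := isIso_of_hom_simple h0
  rw [← cancel_epi (kirby Y ▷ Z), Category.comp_id]
  exact h

end Kirby

/-! ### The two evaluations of the encircled crossing. -/

section Indicator

variable {C : Type u} [Category.{v} C] [Abelian C] [Linear ℂ C] [MonoidalCategory C]
  [MonoidalPreadditive C] [MonoidalLinear ℂ C] [RightRigidCategory C] [BraidedCategory C]
  [RibbonCategory C] [FusionCategory C]

theorem twist_eq_smul_id (X : C) [Simple X] : (twist X).hom = twistScalar X • 𝟙 X :=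
  (scalar_smul_id _).symm

theorem rotation_eq (X : C) [Simple X] :
    rotation X = twistScalar X • RMatrix (𝟙_ C) X := by
  ext f
  change coevR X Xᘁ ≫ _ = twistScalar X • (f ≫ (β_ X X).hom)
  rw [rotation_formula, twist_eq_smul_id, MonoidalLinear.smul_whiskerRight]
  simp

theorem trace_RMatrix_congr {Z Z' : C} (e : Z ≅ Z') (X : C) :
    LinearMap.trace ℂ (Z ⟶ X ⊗ X) (RMatrix Z X) =
      LinearMap.trace ℂ (Z' ⟶ X ⊗ X) (RMatrix Z' X) := by
  rw [← LinearMap.trace_conj' (RMatrix Z X) (Linear.homCongr ℂ e (Iso.refl (X ⊗ X)))]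
  congr 1
  ext f
  simp [RMatrix, LinearEquiv.conj_apply, Linear.homCongr]

theorem secondIndicator_eq (X : C) [Simple X] :
    secondIndicator X = twistScalar X * LinearMap.trace ℂ _ (RMatrix (𝟙_ C) X) := by
  rw [secondIndicator, rotation_eq, map_smul, smul_eq_mul]

-- By naturality the loop on `X ⊗ X` acts on `Hom(γ, X ⊗ X)` through its scalar on `γ`, which is
-- `D²` or `0`.
open Classical in
theorem qtrace_kirby_braiding_eq_transparent (X : C) :
    qtrace (kirby (X ⊗ X) ≫ (β_ X X).hom) = globalDim C * ∑ γ : Irr C with IsTransparent γ.rep,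
      dim γ.rep * LinearMap.trace ℂ (γ.rep ⟶ X ⊗ X) (RMatrix γ.rep X) := by
  rw [qtrace_eq_sum_trace, Finset.mul_sum, Finset.sum_filter]
  refine Finset.sum_congr rfl fun γ _ => ?_
  split_ifs with h
  · have h2 : Linear.rightComp ℂ γ.rep (kirby (X ⊗ X) ≫ (β_ X X).hom) =
        globalDim C • RMatrix γ.rep X := by
      ext f
      change f ≫ kirby (X ⊗ X) ≫ (β_ X X).hom = globalDim C • (f ≫ (β_ X X).hom)
      rw [← Category.assoc, kirby_naturality, kirby_of_isTransparent h]
      simp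
    rw [h2, map_smul, smul_eq_mul]
    ring
  · have h2 : Linear.rightComp ℂ γ.rep (kirby (X ⊗ X) ≫ (β_ X X).hom) = 0 := by
      ext f
      change f ≫ kirby (X ⊗ X) ≫ _ = 0
      rw [← Category.assoc, kirby_naturality, kirby_of_not_isTransparent h]
      simp
    rw [h2, map_zero, mul_zero]

theorem doubleBraiding_eq (X Y : C) [Simple X] [Simple Y] :
    doubleBraiding X Y = (twistScalar X * twistScalar Y)⁻¹ • (twist (X ⊗ Y)).hom := by
  have h : (twist (X ⊗ Y)).hom = (twistScalar X * twistScalar Y) • doubleBraiding X Y := by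
    rw [twist_tensor, twist_eq_smul_id X, twist_eq_smul_id Y, MonoidalCategory.tensorHom_def,
      MonoidalLinear.smul_whiskerRight, MonoidalLinear.whiskerLeft_smul]
    simp [doubleBraiding, smul_smul, mul_comm]
  rw [h, smul_smul, inv_mul_cancel₀ (mul_ne_zero (twistScalar_ne_zero X) (twistScalar_ne_zero Y)),
    one_smul]

/-- Balancing makes the squared double braiding `(θ_c / (θ_b θ_X))²` on a summand `c`; the extra
twist of `X` leaves one factor `θ_X⁻¹`. -/
theorem qtrace_doubleBraiding_sq (b X : C) [Simple b] [Simple X] :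
    qtrace (b ◁ (twist X).hom ≫ doubleBraiding b X ≫ doubleBraiding b X) =
      (twistScalar X)⁻¹ * ∑ c : Irr C, (fusionCoeff b X c.rep : ℂ) * dim c.rep *
        (twistScalar c.rep / twistScalar b) ^ 2 := by
  have hX := twistScalar_ne_zero X
  have hb := twistScalar_ne_zero b
  have h : b ◁ (twist X).hom ≫ doubleBraiding b X ≫ doubleBraiding b X =
      (twistScalar X * ((twistScalar b * twistScalar X)⁻¹ * (twistScalar b * twistScalar X)⁻¹)) •
        ((twist (b ⊗ X)).hom ≫ (twist (b ⊗ X)).hom) := by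
    rw [doubleBraiding_eq, twist_eq_smul_id X, MonoidalLinear.whiskerLeft_smul]
    simp only [whiskerLeft_id, Linear.smul_comp, Linear.comp_smul, Category.id_comp, smul_smul]
    congr 1
    ring
  rw [h, qtrace_smul, qtrace_resolution (resolution (b ⊗ X)), Finset.mul_sum, Finset.mul_sum]
  refine Finset.sum_congr rfl fun c _ => ?_
  have h2 : ∀ j, scalar ((resolution (b ⊗ X)).i c j ≫
      ((twist (b ⊗ X)).hom ≫ (twist (b ⊗ X)).hom) ≫ (resolution (b ⊗ X)).p c j) =
      twistScalar c.rep ^ 2 := by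
    intro j
    have h3 := twist_naturality ((resolution (b ⊗ X)).i c j)
    rw [Category.assoc, ← Category.assoc, h3, Category.assoc, ← Category.assoc _ (twist _).hom, h3,
      Category.assoc, (resolution _).i_p, twist_eq_smul_id c.rep]
    simp [scalar_smul, sq]
  simp only [h2, Finset.sum_const, Finset.card_univ, (resolution _).card_eq_finrank_to,
    nsmul_eq_mul, fusionCoeff]
  field_simp

theorem qtrace_kirby_braiding_eq_sum (X : C) [Simple X] :
    twistScalar X * qtrace (kirby (X ⊗ X) ≫ (β_ X X).hom) =
      ∑ b : Irr C, ∑ c : Irr C, (fusionCoeff b.rep c.rep X : ℂ) * dim b.rep * dim c.rep *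
        (twistScalar b.rep / twistScalar c.rep) ^ 2 := by
  have h : ∀ b : Irr C, qtrace (encircle b.rep (b.rep)ᘁ (X ⊗ X) ≫ (β_ X X).hom) =
      (twistScalar X)⁻¹ * ∑ c : Irr C, (fusionCoeff b.rep X c.rep : ℂ) * dim c.rep *
        (twistScalar c.rep / twistScalar b.rep) ^ 2 := by
    intro b
    rw [← qtrace_doubleBraiding_sq, qtrace_eq (X ⊗ X) (Xᘁ ⊗ Xᘁ), Tr_encircle_braiding,
      ← qtrace_eq]
  simp only [kirby, Preadditive.sum_comp, Linear.smul_comp, qtrace_sum, qtrace_smul, h]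
  rw [Finset.mul_sum, Finset.sum_comm (γ := Irr C)]
  -- The loop colour `b` is matched with the second summation index through `b*`, because `N_{bX}^c
  -- = N_{c b*}^X` while `d` and `θ` are invariant under duality.
  refine Finset.sum_bij' (fun b _ => b.dual) (fun b _ => b.dual) (by simp) (by simp)
    (fun b _ => b.dual_dual) (fun b _ => b.dual_dual) fun b _ => ?_
  rw [mul_left_comm (dim _), ← mul_assoc, mul_inv_cancel₀ (twistScalar_ne_zero X), one_mul,
    Finset.mul_sum]
  refine Finset.sum_congr rfl fun c _ => ?_
  have hN : fusionCoeff b.rep X c.rep = fusionCoeff c.rep b.dual.rep X := by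
    let := reversePairing b.rep (b.rep)ᘁ
    rw [fusionCoeff, finrank_tensorLeft X (b.rep)ᘁ b.rep c.rep, finrank_hom_comm_simple,
      finrank_congr_left (β_ (b.rep)ᘁ c.rep),
      ← finrank_congr_left (whiskerLeftIso c.rep (Irr.ofIso (b.rep)ᘁ))]
    rfl
  rw [hN, dim_dual, twistScalar_dual]
  ring

open Classical in
theorem sum_transparent_eq (f : Irr C → ℂ) :
    ∑ γ : Irr C with IsTransparent γ.rep, f γ = f (Irr.of (𝟙_ C)) +
      ∑ γ : Irr C with IsTransparent γ.rep ∧ ¬ Nonempty (γ.rep ≅ 𝟙_ C), f γ := by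
  have h : IsTransparent (Irr.of (𝟙_ C)).rep := by
    intro Y
    have h2 := doubleBraiding_naturality_left (Irr.ofIso (𝟙_ C)).hom Y
    rw [← cancel_mono ((Irr.ofIso (𝟙_ C)).hom ▷ Y)]
    change doubleBraiding _ _ ≫ _ = _
    rw [← h2]
    simp [doubleBraiding]
  rw [← Finset.filter_filter, ← Finset.sum_erase_add _ _
    (Finset.mem_filter.2 ⟨Finset.mem_univ _, h⟩ :
      Irr.of (𝟙_ C) ∈ Finset.univ.filter fun γ : Irr C => IsTransparent γ.rep), add_comm]
  congr 2
  ext γ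
  simp only [Finset.mem_erase, Finset.mem_filter, Finset.mem_univ, true_and]
  rw [and_comm]
  refine and_congr_right fun _ => not_congr ⟨?_, fun h3 =>
    (Irr.of_eq (X := 𝟙_ C) h3).symm⟩
  rintro rfl
  exact ⟨Irr.ofIso _⟩

end Indicator
end
end Premodular

/-! ### The indicator formula. -/

open CategoryTheory MonoidalCategory Premodular in
open scoped Classical in
theorem mainTheorem2 (C : Type u) [Category.{v} C] [Abelian C] [Linear ℂ C] [MonoidalCategory C]
    [MonoidalPreadditive C] [MonoidalLinear ℂ C] [RightRigidCategory C] [BraidedCategory C]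
    [RibbonCategory C] [FusionCategory C]
    (X : C) [Simple X] (selfDual : Nonempty (Xᘁ ≅ X)) :
    globalDim C ≠ 0 ∧
    secondIndicator X =
      1 / globalDim C * ∑ b : Irr C, ∑ c : Irr C,
          (fusionCoeff b.rep c.rep X : ℂ) * dim b.rep * dim c.rep *
            (twistScalar b.rep / twistScalar c.rep) ^ 2
        - twistScalar X * ∑ γ : Irr C with IsTransparent γ.rep ∧ ¬ Nonempty (γ.rep ≅ 𝟙_ C),
            dim γ.rep * LinearMap.trace ℂ (γ.rep ⟶ X ⊗ X) (RMatrix γ.rep X) := by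
  refine ⟨globalDim_ne_zero, ?_⟩
  -- Equating the two evaluations cancels `D²`; splitting off `γ = 𝟙`, of dimension `1`, isolates
  -- the indicator.
  rw [← qtrace_kirby_braiding_eq_sum, qtrace_kirby_braiding_eq_transparent, sum_transparent_eq,
    secondIndicator_eq, dim_congr (Irr.ofIso (𝟙_ C)), dim_unit,
    trace_RMatrix_congr (Irr.ofIso (𝟙_ C))]
  have := globalDim_ne_zero (C := C)
  field_simp
  ring
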